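/- Let $L>0$, let $\mathbb{T}^2=(\mathbb{R}/L\mathbb{Z})^2$ be the flat torus, and for $k\in\mathbb{N}\cup\{0\}$ let $W^{k,2}(\mathbb{T}^2)$ be the space of real-valued $v\in L^2(\mathbb{T}^2)$ with finite norm $\|v\|_{k,2}=\big(\sum_{\xi\in\mathbb{Z}^2}(1+|\xi|^2)^k|\widehat v(\xi)|^2\big)^{1/2}$, where $\widehat v(\xi)$ are the Fourier coefficients of $v$; for a vector field $v=(v_1,v_2)$ put $\|v\|_{k,2}=(\|v_1\|_{k,2}^2+\|v_2\|_{k,2}^2)^{1/2}$. Let $\mathcal{M}=W^{3,2}(\mathbb{T}^2)\times W^{2,2}(\mathbb{T}^2)$ with $\|(b,\omega)\|_{\mathcal M}=\|b\|_{3,2}+\|\omega\|_{2,2}$. Fix $\alpha>0$, a divergence-free vector field $\mathbf{u}_h\in W^{3,2}(\mathbb{T}^2;\mathbb{R}^2)$, $f\in W^{2,2}(\mathbb{T}^2)$ and $(b_0,\omega_0)\in\mathcal{M}$. For $T>0$, a triple $(b,\omega,T)$ is called a local strong solution of the $\alpha$-TQG system if $b\in C([0,T];W^{3,2}(\mathbb{T}^2))$,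 $\omega\in C([0,T];W^{2,2}(\mathbb{T}^2))$ and, for all $t\in[0,T]$, as identities in $L^2(\mathbb{T}^2)$, $$b(t)=b_0-\int_0^t\mathrm{div}(b\,\mathbf{u})\,d\tau,\qquad \omega(t)=\omega_0-\int_0^t\big[\mathrm{div}((\omega-b)\mathbf{u})+\mathrm{div}(b\,\mathbf{u}_h)\big]\,d\tau,$$ where $\mathbf{u}=\nabla^\perp\psi=(-\partial_y\psi,\partial_x\psi)$ and $\psi(t)\in W^{4,2}(\mathbb{T}^2)$ solves $\omega=(\Delta-1)(1-\alpha\Delta)\psi+f$. A triple $(b^\alpha,\omega^\alpha,T^\alpha_{\max})$ with $T^\alpha_{\max}\in(0,\infty]$ is called a maximal solution if there is an increasing sequence $(T_n)_{n\in\mathbb{N}}$ with limit $T^\alpha_{\max}$ such that $(b^\alpha,\omega^\alpha,T_n)$ is a local strong solution for each $n$ and such that, if $T^\alpha_{\max}<\infty$, then $\limsup_{n\to\infty}\|(b^\alpha,\omega^\alpha)(T_n)\|_{\mathcal{M}}^2=\infty$. Theorem. Let $(b^\alpha,\omega^\alpha,T^\alpha_{\max})$ be a maximal solution of the $\alpha$-TQG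 system. If $T^\alpha_{\max}<\infty$, then $$\int_0^{T^\alpha_{\max}}\|\nabla b^\alpha\|_{1,2}\,dt=\infty.$$ -/

import Mathlib

open MeasureTheory Filter Topology Set
open scoped ENNReal

noncomputable section

namespace TQG

/-! ### The flat torus, Fourier coefficients and Sobolev spaces -/

/-- The two-dimensional flat torus `(ℝ / L ℤ)²` of side length `L`. -/
abbrev Torus (L : ℝ) : Type := Fin 2 → AddCircle L

/-- Normalised Lebesgue (Haar) measure on the torus. -/
def torusMeasure (L : ℝ) [Fact (0 < L)] : Measure (Torus L) :=
  Measure.pi fun _ => AddCircle.haarAddCircle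

/-- The space `L²(𝕋²)` of real-valued square-integrable functions (modulo a.e. equality). -/
abbrev L2 (L : ℝ) [Fact (0 < L)] : Type := Lp ℝ 2 (torusMeasure L)

variable {L : ℝ} [Fact (0 < L)]

/-- The character `x ↦ exp (2 π i ξ ⬝ x / L)` of the torus. -/
def character (ξ : Fin 2 → ℤ) (x : Torus L) : ℂ := ∏ j, fourier (ξ j) (x j)

/-- The Fourier coefficient `v̂(ξ)`. -/
def coeff (v : L2 L) (ξ : Fin 2 → ℤ) : ℂ :=
  ∫ x, character (-ξ) x * ((v x : ℝ) : ℂ) ∂(torusMeasure L)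

/-- `‖v‖_{k,2} = (∑_ξ (1 + |ξ|²)^k |v̂(ξ)|²)^{1/2}`, with value `∞` if `v ∉ W^{k,2}(𝕋²)`. -/
def sobolevNorm (k : ℕ) (v : L2 L) : ℝ≥0∞ :=
  (∑' ξ : Fin 2 → ℤ,
    ENNReal.ofReal ((1 + ∑ j, (ξ j : ℝ) ^ 2) ^ k * ‖coeff v ξ‖ ^ 2)) ^ (1 / 2 : ℝ)

/-- The norm `‖v‖_{k,2}` of a vector field. -/
def vectorSobolevNorm (k : ℕ) (v : Fin 2 → L2 L) : ℝ≥0∞ :=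
  (∑ j, sobolevNorm k (v j) ^ 2) ^ (1 / 2 : ℝ)

/-- `v ∈ W^{k,2}(𝕋²)`. -/
def MemSobolev (k : ℕ) (v : L2 L) : Prop := sobolevNorm k v < ∞

/-- `v ∈ C([0,T]; W^{k,2}(𝕋²))`. -/
def ContinuousInSobolev (k : ℕ) (T : ℝ) (v : ℝ → L2 L) : Prop :=
  (∀ t ∈ Icc 0 T, MemSobolev k (v t)) ∧
    ∀ t ∈ Icc 0 T, Tendsto (fun s => sobolevNorm k (v s - v t)) (𝓝[Icc 0 T] t) (𝓝 0)

/-! ### Differential operators and products -/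

/-- `g ∈ L²` is the weak (distributional) derivative `∂_j v`: integration by parts holds against
every character, that is, `ĝ(ξ) = (2 π i ξ_j / L) v̂(ξ)` for every `ξ`. -/
def HasWeakDeriv (j : Fin 2) (v g : L2 L) : Prop :=
  ∀ ξ : Fin 2 → ℤ, coeff g ξ = (2 * Real.pi * Complex.I * (ξ j : ℂ) / (L : ℂ)) * coeff v ξ

open Classical in
/-- The weak derivative `∂_j v` (a unique element of `L²` whenever it exists in `L²`, which is the
case for `v ∈ W^{1,2}`; the default value `0` otherwise). -/
def weakDeriv (j : Fin 2) (v : L2 L) : L2 L :=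
  if h : ∃ g, HasWeakDeriv j v g then h.choose else 0

/-- The gradient `∇ v`. -/
def grad (v : L2 L) : Fin 2 → L2 L := fun j => weakDeriv j v

/-- The rotated gradient `∇^⊥ v = (-∂_y v, ∂_x v)`. -/
def perpGrad (v : L2 L) : Fin 2 → L2 L := ![-weakDeriv 1 v, weakDeriv 0 v]

/-- The divergence of a vector field. -/
def divergence (u : Fin 2 → L2 L) : L2 L := weakDeriv 0 (u 0) + weakDeriv 1 (u 1)

/-- The Laplacian `Δ v = ∂_x² v + ∂_y² v`. -/
def laplacian (v : L2 L) : L2 L := divergence (grad v)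

open Classical in
/-- The pointwise product `v w` (when it belongs to `L²`, as it does if one of the factors is in
`W^{2,2} ⊂ L^∞`; the default value `0` otherwise). -/
def mul (v w : L2 L) : L2 L :=
  if h : MemLp (fun x => (v x : ℝ) * (w x : ℝ)) 2 (torusMeasure L) then h.toLp _ else 0

/-- The product `v u` of a scalar function and a vector field. -/
def mulVec (v : L2 L) (u : Fin 2 → L2 L) : Fin 2 → L2 L := fun j => mul v (u j)

/-! ### The `α`-TQG system -/

/-- `‖(b, ω)‖_𝓜 = ‖b‖_{3,2} + ‖ω‖_{2,2}`, the norm of `𝓜 = W^{3,2}(𝕋²) × W^{2,2}(𝕋²)`. -/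
def normM (b ω : L2 L) : ℝ≥0∞ := sobolevNorm 3 b + sobolevNorm 2 ω

/-- The standing assumption on the data:
`u_h ∈ W^{3,2}_div(𝕋²; ℝ²)`, `f ∈ W^{2,2}(𝕋²)` and `(b₀, ω₀) ∈ 𝓜`. -/
structure DataAssumption (uh : Fin 2 → L2 L) (f b₀ ω₀ : L2 L) : Prop where
  uh_mem : ∀ j, MemSobolev 3 (uh j)
  uh_div : divergence uh = 0
  f_mem : MemSobolev 2 f
  b_mem : MemSobolev 3 b₀
  omega_mem : MemSobolev 2 ω₀

/-- `ψ` is the streamfunction of the potential vorticity `ω`: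
`ω = (Δ - 1)(1 - α Δ) ψ + f`. -/
def IsStreamfunction (α : ℝ) (f ω ψ : L2 L) : Prop :=
  MemSobolev 4 ψ ∧
    ω = laplacian (ψ - α • laplacian ψ) - (ψ - α • laplacian ψ) + f

/-- `(b, ω, T)` is a local strong solution of the `α`-TQG system with data `u_h`, `f` and initial
condition `(b₀, ω₀)`. The velocity is `u = ∇^⊥ ψ`, with `ψ` the streamfunction of `ω`; the time
integrals are Bochner integrals in `L²(𝕋²)`. -/
def IsLocalSolution (α : ℝ) (uh : Fin 2 → L2 L) (f b₀ ω₀ : L2 L)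
    (b ω : ℝ → L2 L) (T : ℝ) : Prop :=
  0 < T ∧ ContinuousInSobolev 3 T b ∧ ContinuousInSobolev 2 T ω ∧
    ∃ ψ : ℝ → L2 L, (∀ t ∈ Icc 0 T, IsStreamfunction α f (ω t) (ψ t)) ∧
      (∀ t ∈ Icc 0 T,
        b t = b₀ - ∫ τ in (0 : ℝ)..t, divergence (mulVec (b τ) (perpGrad (ψ τ)))) ∧
      (∀ t ∈ Icc 0 T,
        ω t = ω₀ - ∫ τ in (0 : ℝ)..t,
          (divergence (mulVec (ω τ - b τ) (perpGrad (ψ τ))) + divergence (mulVec (b τ) uh)))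

/-- `(b, ω, T_max)` is a maximal solution, `T_max ∈ (0, ∞]`. -/
def IsMaximalSolution (α : ℝ) (uh : Fin 2 → L2 L) (f b₀ ω₀ : L2 L)
    (b ω : ℝ → L2 L) (Tmax : ℝ≥0∞) : Prop :=
  0 < Tmax ∧ ∃ T : ℕ → ℝ, StrictMono T ∧
    Tendsto (fun n => ENNReal.ofReal (T n)) atTop (𝓝 Tmax) ∧
    (∀ n, IsLocalSolution α uh f b₀ ω₀ b ω (T n)) ∧
    (Tmax < ∞ → limsup (fun n => normM (b (T n)) (ω (T n)) ^ 2) atTop = ∞)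

end TQG

end

noncomputable section

namespace TQG

open scoped ComplexConjugate

section FourierSeries

variable {L : ℝ} [Fact (0 < L)]

/-! ### Fourier series on the torus -/

/-! Suppose the integral is finite. For `α > 0` the velocity is three derivatives smoother than the
potential vorticity: its `W^{3,2}` norm is bounded by the `L²` norm of `ω - f`
(`IsStreamfunction.velNorm_le`). So everything reduces to bounding `‖ω‖` in `L²`; once this is done,
`u` is a bounded divergence-free field in `W^{3,2}` and the estimates for `b` and `ω` become linear.

The vorticity is transported by `u` and forced by `div(b u_h) - div(b u)`. In `L²` the transport
contributes nothing, and since both fields are divergence free the forcing costs only `‖∇b‖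
(‖u_h‖_{3,2} + ‖u‖_{3,2})` with `‖∇b‖` taken in `L²`. Hence `1 + ‖ω‖²` obeys a Grönwall inequality
whose rate is a multiple of `‖∇b‖` (`exists_l2_bound`). A second Grönwall argument bounds
`‖b‖_{3,2}² + ‖ω‖_{2,2}²` up to the final time (`exists_sobolev_bound`), contradicting the blow-up
along `T n`.

All estimates take place on the Fourier side: Sobolev norms are weighted `ℓ²` norms, products are
convolutions, and Young's inequality is combined with `W^{2,2} ⊂ ℱℓ¹`. For a divergence-free field
the energy pairing has an antisymmetric kernel, so it sees only increments of the weight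
(`enorm_two_mul_sum_antisymm_le`); `bracket_commutator` then shows that no derivative is lost. Since
the equations hold only in `L²`, the weights are first cut off to finite support with controlled
increments, and the cutoff is removed in `sobolevNorm_sq_le_of_weights`. -/

instance : IsProbabilityMeasure (torusMeasure L) :=
  inferInstanceAs (IsProbabilityMeasure (Measure.pi fun _ : Fin 2 => AddCircle.haarAddCircle (T := L)))

/-- The character of the torus with frequency `ξ`, as a continuous map. -/
def characterMap (L : ℝ) [Fact (0 < L)] (ξ : Fin 2 → ℤ) : C(Torus L, ℂ) where
  toFun := character ξ
  continuous_toFun := by unfold character; fun_prop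

theorem characterMap_apply (ξ : Fin 2 → ℤ) (x : Torus L) :
    characterMap L ξ x = ∏ j, fourier (ξ j) (x j) := rfl

theorem character_neg {L : ℝ} (ξ : Fin 2 → ℤ) (x : Torus L) :
    character (-ξ) x = conj (character ξ x) := by
  simp only [character, Pi.neg_apply, fourier_neg, map_prod]

theorem character_add {L : ℝ} (ξ η : Fin 2 → ℤ) (x : Torus L) :
    character (ξ + η) x = character ξ x * character η x := by
  simp only [character, Pi.add_apply, fourier_add, ← Finset.prod_mul_distrib]

theorem norm_character {L : ℝ} (ξ : Fin 2 → ℤ) (x : Torus L) : ‖character ξ x‖ = 1 := by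
  simp only [character, fourier_apply, norm_prod, Circle.norm_coe, Finset.prod_const_one]

theorem characterMap_single (i : Fin 2) (x : Torus L) :
    characterMap L (Pi.single i 1) x = fourier 1 (x i) := by
  fin_cases i <;> simp [characterMap_apply, Fin.prod_univ_two]

/-- The star subalgebra of continuous functions generated by the characters. -/
def characterSubalgebra (L : ℝ) [Fact (0 < L)] : StarSubalgebra ℂ C(Torus L, ℂ) where
  toSubalgebra := Algebra.adjoin ℂ (range (characterMap L))
  star_mem' := by
    change Algebra.adjoin ℂ (range (characterMap L)) ≤
      star (Algebra.adjoin ℂ (range (characterMap L)))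
    refine Algebra.adjoin_le ?_
    rintro _ ⟨n, rfl⟩
    refine Algebra.subset_adjoin ⟨-n, ?_⟩
    ext1 x
    exact character_neg n x

theorem characterSubalgebra_coe :
    (characterSubalgebra L).toSubalgebra.toSubmodule =
      Submodule.span ℂ (range (characterMap L)) := by
  apply Algebra.adjoin_eq_span_of_subset
  refine .trans (fun x ↦ Submonoid.closure_induction (fun _ ↦ id) ⟨0, ?_⟩ ?_)
    Submodule.subset_span
  · ext z
    simp [characterMap_apply]
  · rintro _ _ _ _ ⟨m, rfl⟩ ⟨n, rfl⟩
    refine ⟨m + n, ?_⟩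
    ext z
    exact character_add m n z

theorem characterSubalgebra_separatesPoints : (characterSubalgebra L).SeparatesPoints := by
  intro x y hxy
  rw [Ne, funext_iff, not_forall] at hxy
  obtain ⟨i, hi⟩ := hxy
  refine ⟨_, ⟨characterMap L (Pi.single i 1),
    Algebra.subset_adjoin ⟨Pi.single i 1, rfl⟩, rfl⟩, ?_⟩
  dsimp only
  rw [characterMap_single, characterMap_single, fourier_one, fourier_one]
  exact fun h => hi (AddCircle.injective_toCircle (Fact.out : 0 < L).ne' (Circle.ext h))

theorem span_characterMap_closure_eq_top :
    (Submodule.span ℂ (range (characterMap L))).topologicalClosure = ⊤ := by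
  rw [← characterSubalgebra_coe]
  exact congr_arg (Subalgebra.toSubmodule <| StarSubalgebra.toSubalgebra ·)
    (ContinuousMap.starSubalgebra_topologicalClosure_eq_top_of_separatesPoints _
      characterSubalgebra_separatesPoints)

/-- The characters as elements of the complex `L²` space. -/
abbrev characterLp (L : ℝ) [Fact (0 < L)] (ξ : Fin 2 → ℤ) : Lp ℂ 2 (torusMeasure L) :=
  ContinuousMap.toLp (E := ℂ) 2 (torusMeasure L) ℂ (characterMap L ξ)

theorem span_characterLp_closure_eq_top :
    (Submodule.span ℂ (range (characterLp L))).topologicalClosure = ⊤ := by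
  simpa only [Submodule.map_span, ContinuousLinearMap.coe_coe, ← range_comp, Function.comp_def]
    using (ContinuousMap.toLp_denseRange ℂ (torusMeasure L) ℂ
      ENNReal.ofNat_ne_top).topologicalClosure_map_submodule span_characterMap_closure_eq_top

theorem integral_character (ξ : Fin 2 → ℤ) :
    ∫ x, character ξ x ∂(torusMeasure L) = if ξ = 0 then 1 else 0 := by
  split_ifs with h
  · simp [h, character]
  · unfold character torusMeasure
    rw [MeasureTheory.integral_fintype_prod_eq_prod (𝕜 := ℂ)
      (fun j (y : AddCircle L) => fourier (ξ j) y)]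
    obtain ⟨i, hi⟩ := Function.ne_iff.mp h
    apply Finset.prod_eq_zero (Finset.mem_univ i)
    -- Pairing with the constant mode shows that the factor of the product integral in a coordinate
    -- with `ξ i ≠ 0` vanishes.
    have := (orthonormal_iff_ite.mp (orthonormal_fourier (T := L))) 0 (ξ i)
    rw [if_neg (fun h => hi h.symm)] at this
    simpa only [ContinuousMap.inner_toLp, ← fourier_neg, ← fourier_add, neg_zero, zero_add,
      add_zero] using! this

theorem orthonormal_characterLp : Orthonormal ℂ (characterLp L) := by
  rw [orthonormal_iff_ite]
  intro m n
  have h : ∀ x : Torus L, characterMap L n x * conj (characterMap L m x) = character (n - m) x := by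
    intro x
    rw [sub_eq_add_neg, character_add, character_neg]; rfl
  simp only [ContinuousMap.inner_toLp]
  simp only [h, integral_character, sub_eq_zero, eq_comm (a := n)]

/-- The Hilbert basis of characters. -/
def characterBasis (L : ℝ) [Fact (0 < L)] :
    HilbertBasis (Fin 2 → ℤ) ℂ (Lp ℂ 2 (torusMeasure L)) :=
  HilbertBasis.mk orthonormal_characterLp span_characterLp_closure_eq_top.ge

theorem characterBasis_repr (g : Lp ℂ 2 (torusMeasure L)) (ξ : Fin 2 → ℤ) :
    (characterBasis L).repr g ξ = ∫ x, character (-ξ) x * g x ∂(torusMeasure L) := by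
  rw [(characterBasis L).repr_apply_apply g ξ, MeasureTheory.L2.inner_def, characterBasis,
    HilbertBasis.coe_mk]
  apply integral_congr_ae
  filter_upwards [ContinuousMap.coeFn_toLp (p := 2) (𝕜 := ℂ) (torusMeasure L) (characterMap L ξ)]
    with x hx
  rw [hx, RCLike.inner_apply, character_neg, mul_comm]; rfl

/-- The complexification `L²(𝕋²; ℝ) → L²(𝕋²; ℂ)`. -/
def complexify (L : ℝ) [Fact (0 < L)] : L2 L →L[ℝ] Lp ℂ 2 (torusMeasure L) :=
  Complex.ofRealCLM.compLpL 2 (torusMeasure L)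

theorem coeFn_complexify (v : L2 L) :
    complexify L v =ᵐ[torusMeasure L] fun x => ((v x : ℝ) : ℂ) :=
  Complex.ofRealCLM.coeFn_compLpL v

theorem repr_complexify (v : L2 L) (ξ : Fin 2 → ℤ) :
    (characterBasis L).repr (complexify L v) ξ = coeff v ξ := by
  rw [characterBasis_repr, coeff]
  apply integral_congr_ae
  filter_upwards [coeFn_complexify v] with x hx
  rw [hx]

theorem norm_complexify (v : L2 L) : ‖complexify L v‖ = ‖v‖ := by
  rw [Lp.norm_def, Lp.norm_def]
  congr 1
  rw [eLpNorm_congr_ae (coeFn_complexify v)]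
  exact eLpNorm_congr_norm_ae (by simp)

/-- The Fourier coefficient as a continuous real-linear map. -/
def coeffCLM (L : ℝ) [Fact (0 < L)] (ξ : Fin 2 → ℤ) : L2 L →L[ℝ] ℂ :=
  ((innerSL ℂ (characterBasis L ξ)).restrictScalars ℝ).comp (complexify L)

@[simp]
theorem coeffCLM_apply (ξ : Fin 2 → ℤ) (v : L2 L) : coeffCLM L ξ v = coeff v ξ := by
  rw [← repr_complexify, HilbertBasis.repr_apply_apply]; rfl

theorem coeff_add (v w : L2 L) (ξ : Fin 2 → ℤ) : coeff (v + w) ξ = coeff v ξ + coeff w ξ := by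
  simp only [← coeffCLM_apply, map_add]

theorem coeff_sub (v w : L2 L) (ξ : Fin 2 → ℤ) : coeff (v - w) ξ = coeff v ξ - coeff w ξ := by
  simp only [← coeffCLM_apply, map_sub]

theorem coeff_neg (v : L2 L) (ξ : Fin 2 → ℤ) : coeff (-v) ξ = -coeff v ξ := by
  simp only [← coeffCLM_apply, map_neg]

theorem coeff_smul (c : ℝ) (v : L2 L) (ξ : Fin 2 → ℤ) : coeff (c • v) ξ = c * coeff v ξ := by
  simp only [← coeffCLM_apply, map_smul, Complex.real_smul]

theorem coeff_zero (ξ : Fin 2 → ℤ) : coeff (0 : L2 L) ξ = 0 := by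
  simp only [← coeffCLM_apply, map_zero]

/-- Fourier coefficients of a real function are Hermitian. -/
theorem coeff_neg_freq (v : L2 L) (ξ : Fin 2 → ℤ) : coeff v (-ξ) = conj (coeff v ξ) := by
  rw [coeff, coeff, ← integral_conj]
  congr 1
  ext x
  rw [map_mul, ← character_neg, Complex.conj_ofReal]

/-- Completeness of the characters. Algebraic identities for products and weak derivatives are
checked coefficientwise through this. -/
theorem coeff_injective {v w : L2 L} (h : ∀ ξ, coeff v ξ = coeff w ξ) : v = w := by
  have h0 : complexify L (v - w) = 0 := by
    apply (characterBasis L).repr.injective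
    ext ξ
    rw [repr_complexify, coeff_sub, h, sub_self, map_zero]; rfl
  rw [← sub_eq_zero, ← norm_eq_zero, ← norm_complexify, h0, norm_zero]

/-- **Parseval's identity**. -/
theorem hasSum_norm_coeff_sq (v : L2 L) : HasSum (fun ξ => ‖coeff v ξ‖ ^ 2) (‖v‖ ^ 2) := by
  rw [← norm_complexify, ← (characterBasis L).repr.norm_map]
  have := lp.hasSum_norm (p := 2) (by norm_num) ((characterBasis L).repr (complexify L v))
  simpa [repr_complexify] using this

theorem memLp_character_mul (ξ : Fin 2 → ℤ) (v : L2 L) :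
    MemLp (fun x => character ξ x * ((v x : ℝ) : ℂ)) 2 (torusMeasure L) := by
  have hv : MemLp (fun x => ((v x : ℝ) : ℂ)) 2 (torusMeasure L) :=
    (memLp_congr_ae (coeFn_complexify v)).mp (Lp.memLp _)
  refine hv.of_le ((characterMap L ξ).continuous.aestronglyMeasurable.mul
    hv.aestronglyMeasurable) (Eventually.of_forall fun x => ?_)
  rw [norm_mul, norm_character, one_mul]

/-- The coefficients of a product of `L²` functions. -/
theorem hasSum_coeff_mul (v w : L2 L) (ξ : Fin 2 → ℤ) :
    HasSum (fun η => coeff v η * coeff w (ξ - η))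
      (∫ x, character (-ξ) x * ((v x * w x : ℝ) : ℂ) ∂(torusMeasure L)) := by
  -- The coefficient of `v w` is the inner product of `v` with `character ξ * w`, because `w` is
  -- real; Parseval in polarised form gives the convolution.
  set g := (memLp_character_mul ξ w).toLp _ with hg
  have hgx := (memLp_character_mul ξ w).coeFn_toLp
  have key := (characterBasis L).hasSum_inner_mul_inner g (complexify L v)
  have h1 : ∀ η, inner ℂ (characterBasis L η) g = coeff w (η - ξ) := by
    intro η
    rw [← HilbertBasis.repr_apply_apply, characterBasis_repr, coeff]
    apply integral_congr_ae
    filter_upwards [hgx] with x hx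
    rw [hx, ← mul_assoc, ← character_add]
    congr 2
    abel
  have h2 : inner ℂ g (complexify L v) =
      ∫ x, character (-ξ) x * ((v x * w x : ℝ) : ℂ) ∂(torusMeasure L) := by
    rw [MeasureTheory.L2.inner_def]
    apply integral_congr_ae
    filter_upwards [hgx, coeFn_complexify v] with x hx hx'
    rw [hx, hx', RCLike.inner_apply, map_mul, ← character_neg, Complex.conj_ofReal,
      Complex.ofReal_mul]
    ring
  rw [h2] at key
  refine key.congr_fun fun η => ?_
  rw [← inner_conj_symm, h1, ← coeff_neg_freq, neg_sub, ← HilbertBasis.repr_apply_apply,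
    repr_complexify, mul_comm]

/-- **Riesz–Fischer** for real functions. -/
theorem exists_coeff_eq (a : (Fin 2 → ℤ) → ℂ) (ha : Summable fun ξ => ‖a ξ‖ ^ 2)
    (hconj : ∀ ξ, a (-ξ) = conj (a ξ)) : ∃ v : L2 L, ∀ ξ, coeff v ξ = a ξ := by
  have hmem : Memℓp a 2 := by
    apply memℓp_gen
    simpa using ha
  set g := (characterBasis L).repr.symm ⟨a, hmem⟩ with hg
  have hga : ∀ ξ, ∫ x, character (-ξ) x * g x ∂(torusMeasure L) = a ξ := by
    intro ξ
    rw [← characterBasis_repr, hg, LinearIsometryEquiv.apply_symm_apply]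
  have hint : ∀ ξ, Integrable (fun x => character ξ x * g x) (torusMeasure L) := by
    intro ξ
    have h1 : Integrable g (torusMeasure L) := (Lp.memLp g).integrable one_le_two
    refine h1.mono ((characterMap L ξ).continuous.aestronglyMeasurable.mul
      h1.aestronglyMeasurable) (Eventually.of_forall fun x => ?_)
    rw [norm_mul, norm_character, one_mul]
  -- Taking the real part averages `a ξ` with the conjugate of `a (-ξ)`, which changes nothing for
  -- Hermitian `a`.
  refine ⟨Complex.reCLM.compLpL 2 (torusMeasure L) g, fun ξ => ?_⟩
  have h1 : coeff (Complex.reCLM.compLpL 2 (torusMeasure L) g) ξ =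
      ∫ x, (1 / 2 : ℂ) * (character (-ξ) x * g x + conj (character ξ x * g x))
        ∂(torusMeasure L) := by
    rw [coeff]
    apply integral_congr_ae
    filter_upwards [Complex.reCLM.coeFn_compLpL (p := 2) (μ := torusMeasure L) g] with x hx
    rw [hx, map_mul, ← character_neg, Complex.reCLM_apply, Complex.re_eq_add_conj]
    ring
  have hint' : Integrable (fun x => conj (character ξ x * g x)) (torusMeasure L) :=
    (LinearIsometryEquiv.integrable_comp_iff Complex.conjLIE).mpr (hint ξ)
  rw [h1, integral_const_mul, integral_add (hint _) hint', integral_conj, hga]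
  have := hga (-ξ)
  rw [neg_neg] at this
  rw [this, hconj, Complex.conj_conj]
  ring

/-- A function with absolutely summable Fourier coefficients is bounded. -/
theorem ae_bounded_of_summable_coeff (v : L2 L) (hv : Summable fun ξ => ‖coeff v ξ‖) :
    ∀ᵐ x ∂(torusMeasure L), ‖v x‖ ≤ ∑' ξ, ‖coeff v ξ‖ := by
  have hnorm : ∀ ξ, ‖coeff v ξ • characterMap L ξ‖ ≤ ‖coeff v ξ‖ := by
    intro ξ
    rw [norm_smul]
    refine mul_le_of_le_one_right (norm_nonneg _) ?_
    exact (ContinuousMap.norm_le _ zero_le_one).mpr fun x => (norm_character ξ x).le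
  have hsum : Summable fun ξ => coeff v ξ • characterMap L ξ := .of_norm_bounded hv hnorm
  have h1 : HasSum (fun ξ => coeff v ξ • characterLp L ξ) (complexify L v) := by
    have := (characterBasis L).hasSum_repr (complexify L v)
    have hb : ∀ ξ, characterBasis L ξ = characterLp L ξ := fun ξ => by
      rw [characterBasis, HilbertBasis.coe_mk]
    simpa only [repr_complexify, hb] using this
  -- The Fourier series converges uniformly as well as in `L²`; uniqueness of limits identifies the
  -- two sums.
  have h2 := (ContinuousMap.toLp (E := ℂ) 2 (torusMeasure L) ℂ).hasSum hsum.hasSum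
  have h3 : ContinuousMap.toLp (E := ℂ) 2 (torusMeasure L) ℂ
      (∑' ξ, coeff v ξ • characterMap L ξ) = complexify L v := by
    refine h2.unique ?_
    simpa only [Function.comp_def, map_smul] using h1
  have h4 : ‖∑' ξ, coeff v ξ • characterMap L ξ‖ ≤ ∑' ξ, ‖coeff v ξ‖ :=
    tsum_of_norm_bounded hv.hasSum hnorm
  filter_upwards [coeFn_complexify v, ContinuousMap.coeFn_toLp (p := 2) (𝕜 := ℂ) (torusMeasure L)
    (∑' ξ, coeff v ξ • characterMap L ξ)] with x hx hx'
  rw [h3, hx] at hx'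
  rw [← Complex.norm_real, hx']
  exact (ContinuousMap.norm_coe_le_norm _ x).trans h4

end FourierSeries

/-! ### Weighted sequence spaces over the frequency lattice -/

/-- The frequency lattice `ℤ²`. -/
abbrev Freq : Type := Fin 2 → ℤ

/-- The `ℓ²` norm of a nonnegative sequence. -/
def l2Norm (A : Freq → ℝ≥0∞) : ℝ≥0∞ := (∑' ξ, A ξ ^ 2) ^ (1 / 2 : ℝ)

/-- The convolution of nonnegative sequences. -/
def conv (A B : Freq → ℝ≥0∞) (ξ : Freq) : ℝ≥0∞ := ∑' η, A η * B (ξ - η)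

theorem l2Norm_sq (A : Freq → ℝ≥0∞) : l2Norm A ^ 2 = ∑' ξ, A ξ ^ 2 := by
  rw [l2Norm, ← ENNReal.rpow_natCast, ← ENNReal.rpow_mul]
  norm_num

theorem l2Norm_mono {A B : Freq → ℝ≥0∞} (h : ∀ ξ, A ξ ≤ B ξ) : l2Norm A ≤ l2Norm B := by
  unfold l2Norm
  gcongr with ξ
  exact h ξ

theorem le_of_sq_le_sq {a b : ℝ≥0∞} (h : a ^ 2 ≤ b ^ 2) : a ≤ b :=
  (ENNReal.pow_le_pow_left_iff two_ne_zero).mp h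

theorem l2Norm_const_mul (c : ℝ≥0∞) (A : Freq → ℝ≥0∞) :
    l2Norm (fun ξ => c * A ξ) = c * l2Norm A := by
  have h : l2Norm (fun ξ => c * A ξ) ^ 2 = (c * l2Norm A) ^ 2 := by
    simp only [mul_pow, l2Norm_sq, ENNReal.tsum_mul_left]
  exact le_antisymm (le_of_sq_le_sq h.le) (le_of_sq_le_sq h.ge)

theorem tsum_mul_le_l2Norm (A B : Freq → ℝ≥0∞) : ∑' ξ, A ξ * B ξ ≤ l2Norm A * l2Norm B := by
  have := ENNReal.lintegral_mul_le_Lp_mul_Lq (Measure.count : Measure Freq)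
    Real.HolderConjugate.two_two (f := A) (g := B) (measurable_of_countable _).aemeasurable
    (measurable_of_countable _).aemeasurable
  simpa only [l2Norm, Pi.mul_apply, lintegral_count, ENNReal.rpow_ofNat] using this

theorem l2Norm_add_le (A B : Freq → ℝ≥0∞) :
    l2Norm (fun ξ => A ξ + B ξ) ≤ l2Norm A + l2Norm B := by
  have := ENNReal.lintegral_Lp_add_le (μ := (Measure.count : Measure Freq))
    (f := A) (g := B) (measurable_of_countable _).aemeasurable
    (measurable_of_countable _).aemeasurable (p := 2) one_le_two
  simpa only [l2Norm, Pi.add_apply, lintegral_count, ENNReal.rpow_ofNat] using this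

theorem conv_comm (A B : Freq → ℝ≥0∞) (ξ : Freq) : conv A B ξ = conv B A ξ := by
  unfold conv
  rw [← (Equiv.subLeft ξ).tsum_eq]
  simp only [Equiv.subLeft_apply, sub_sub_cancel, mul_comm]

theorem tsum_sub_right (A : Freq → ℝ≥0∞) (η : Freq) : ∑' ξ, A (ξ - η) = ∑' ξ, A ξ :=
  (Equiv.subRight η).tsum_eq A

theorem tsum_sub_left (A : Freq → ℝ≥0∞) (ξ : Freq) : ∑' η, A (ξ - η) = ∑' ξ, A ξ :=
  (Equiv.subLeft ξ).tsum_eq A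

/-- **Young's inequality** `ℓ² * ℓ¹ ⊂ ℓ²`. -/
theorem l2Norm_conv_le (A B : Freq → ℝ≥0∞) : l2Norm (conv A B) ≤ l2Norm A * ∑' ξ, B ξ := by
  apply le_of_sq_le_sq
  have h1 : ∀ ξ, conv A B ξ ^ 2 ≤ (∑' ξ, B ξ) * ∑' η, A η ^ 2 * B (ξ - η) := by
    intro ξ
    have hs : ∀ x : ℝ≥0∞, (x ^ (1 / 2 : ℝ)) ^ 2 = x := fun x => by
      rw [← ENNReal.rpow_natCast, ← ENNReal.rpow_mul]
      norm_num
    -- Cauchy–Schwarz after splitting `B` into two square roots.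
    have h := tsum_mul_le_l2Norm (fun η => B (ξ - η) ^ (1 / 2 : ℝ))
      (fun η => A η * B (ξ - η) ^ (1 / 2 : ℝ))
    have h' : conv A B ξ = ∑' η, B (ξ - η) ^ (1 / 2 : ℝ) * (A η * B (ξ - η) ^ (1 / 2 : ℝ)) := by
      refine tsum_congr fun η => ?_
      rw [mul_left_comm, ← sq, hs]
    rw [h']
    refine (pow_le_pow_left' h 2).trans_eq ?_
    rw [mul_pow, l2Norm_sq, l2Norm_sq]
    simp only [mul_pow, hs, tsum_sub_left]
  rw [l2Norm_sq, mul_pow, l2Norm_sq]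
  refine (ENNReal.tsum_le_tsum h1).trans_eq ?_
  rw [ENNReal.tsum_mul_left, ENNReal.tsum_comm]
  simp only [ENNReal.tsum_mul_left, tsum_sub_right, ENNReal.tsum_mul_right]
  ring

theorem l2Norm_conv_le' (A B : Freq → ℝ≥0∞) : l2Norm (conv A B) ≤ (∑' ξ, A ξ) * l2Norm B := by
  rw [show conv A B = conv B A from funext (conv_comm A B), mul_comm]
  exact l2Norm_conv_le B A

theorem tsum_mul_conv_le (A B C : Freq → ℝ≥0∞) :
    ∑' ξ, A ξ * conv B C ξ ≤ l2Norm A * l2Norm B * ∑' ξ, C ξ :=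
  (tsum_mul_le_l2Norm _ _).trans ((mul_le_mul_right (l2Norm_conv_le _ _) _).trans_eq
    (mul_assoc _ _ _).symm)

theorem tsum_mul_conv_le' (A B C : Freq → ℝ≥0∞) :
    ∑' ξ, A ξ * conv B C ξ ≤ l2Norm A * (∑' ξ, B ξ) * l2Norm C :=
  (tsum_mul_le_l2Norm _ _).trans ((mul_le_mul_right (l2Norm_conv_le' _ _) _).trans_eq
    (mul_assoc _ _ _).symm)

/-- Tonelli. It moves the factor to be measured in `ℓ¹` from the outer position into the
convolution. -/
theorem tsum_mul_conv_swap (A B C : Freq → ℝ≥0∞) :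
    ∑' ξ, A ξ * conv B C ξ = ∑' ξ, B ξ * conv A (fun ζ => C (-ζ)) ξ := by
  simp only [conv, ← ENNReal.tsum_mul_left]
  rw [ENNReal.tsum_comm]
  refine tsum_congr fun ξ => tsum_congr fun η => ?_
  rw [neg_sub]
  ring

/-! ### The Japanese bracket -/

/-- The Japanese bracket `⟨ξ⟩ = (1 + |ξ|²)^{1/2}`. -/
def bracket (ξ : Freq) : ℝ := √(1 + ∑ j, (ξ j : ℝ) ^ 2)

theorem bracket_sq (ξ : Freq) : bracket ξ ^ 2 = 1 + ∑ j, (ξ j : ℝ) ^ 2 :=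
  Real.sq_sqrt (by positivity)

theorem one_le_bracket (ξ : Freq) : 1 ≤ bracket ξ := by
  rw [bracket, Real.one_le_sqrt]
  linarith [show 0 ≤ ∑ j, (ξ j : ℝ) ^ 2 by positivity]

theorem bracket_pos (ξ : Freq) : 0 < bracket ξ := one_pos.trans_le (one_le_bracket ξ)

theorem bracket_neg (ξ : Freq) : bracket (-ξ) = bracket ξ := by
  simp [bracket]

theorem bracket_add_le (ξ η : Freq) : bracket (ξ + η) ≤ bracket ξ + bracket η := by
  have h1 := bracket_sq ξ
  have h2 := bracket_sq η
  have h3 := bracket_sq (ξ + η)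
  simp only [Fin.sum_univ_two, Pi.add_apply, Int.cast_add] at h1 h2 h3
  -- Cauchy–Schwarz, by way of Lagrange's identity.
  have h4 : (ξ 0 : ℝ) * η 0 + ξ 1 * η 1 ≤ bracket ξ * bracket η := by
    refine (le_abs_self _).trans (abs_le_of_sq_le_sq ?_ (by
      have := bracket_pos ξ; have := bracket_pos η; positivity))
    rw [mul_pow, h1, h2]
    nlinarith [sq_nonneg ((ξ 0 : ℝ) * η 1 - ξ 1 * η 0), sq_nonneg (ξ 0 : ℝ), sq_nonneg (ξ 1 : ℝ),
      sq_nonneg (η 0 : ℝ), sq_nonneg (η 1 : ℝ)]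
  refine (le_abs_self _).trans (abs_le_of_sq_le_sq ?_ (by
      have := bracket_pos ξ; have := bracket_pos η; positivity))
  nlinarith

theorem abs_le_bracket (ξ : Freq) (j : Fin 2) : |(ξ j : ℝ)| ≤ bracket ξ := by
  rw [bracket, ← Real.sqrt_sq_eq_abs]
  apply Real.sqrt_le_sqrt
  have := Finset.single_le_sum (f := fun j => (ξ j : ℝ) ^ 2) (fun i _ => sq_nonneg _)
    (Finset.mem_univ j)
  linarith

theorem summable_bracket_inv : Summable fun ξ : Freq => (bracket ξ ^ 4)⁻¹ := by
  have h1 := EisensteinSeries.summable_one_div_norm_rpow (k := 4) (by norm_num)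
  -- The lattice sum has the term `0` at the origin, a negative power of zero, whereas the bracket
  -- there equals `1`; this indicator makes up for it.
  have h2 : Summable (fun ξ : Freq => if ξ = 0 then (1 : ℝ) else 0) :=
    summable_of_ne_finset_zero (s := {0}) fun ξ hξ => if_neg (by simpa using hξ)
  refine .of_nonneg_of_le (fun ξ => by have := bracket_pos ξ; positivity) (fun ξ => ?_) (h1.add h2)
  split_ifs with h
  · subst h
    simp [bracket]
  · rw [add_zero]
    have h0 : 0 < ‖ξ‖ := norm_pos_iff.mpr h
    rw [Real.rpow_neg h0.le, show (4 : ℝ) = ((4 : ℕ) : ℝ) by norm_num, Real.rpow_natCast]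
    gcongr
    refine (pi_norm_le_iff_of_nonneg (bracket_pos ξ).le).mpr fun j => ?_
    simpa [Int.norm_eq_abs] using abs_le_bracket ξ j

/-- The Japanese bracket with values in `[0, ∞]`. -/
def ebracket (ξ : Freq) : ℝ≥0∞ := ENNReal.ofReal (bracket ξ)

theorem one_le_ebracket (ξ : Freq) : 1 ≤ ebracket ξ := by
  simpa [ebracket] using one_le_bracket ξ

theorem ebracket_ne_top (ξ : Freq) : ebracket ξ ≠ ∞ := ENNReal.ofReal_ne_top

theorem ebracket_ne_zero (ξ : Freq) : ebracket ξ ≠ 0 :=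
  (one_pos.trans_le (one_le_ebracket ξ)).ne'

theorem ebracket_neg (ξ : Freq) : ebracket (-ξ) = ebracket ξ := by
  rw [ebracket, bracket_neg, ebracket]

theorem ebracket_le_add (ξ η : Freq) : ebracket ξ ≤ ebracket η + ebracket (ξ - η) := by
  rw [ebracket, ebracket, ebracket, ← ENNReal.ofReal_add (bracket_pos _).le (bracket_pos _).le]
  apply ENNReal.ofReal_le_ofReal
  simpa using bracket_add_le η (ξ - η)

theorem ebracket_sq_le (ξ η : Freq) :
    ebracket ξ ^ 2 ≤ 2 * ebracket η ^ 2 + 2 * ebracket (ξ - η) ^ 2 := by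
  rw [ebracket, ebracket, ebracket]
  have h1 := bracket_add_le η (ξ - η)
  rw [add_sub_cancel] at h1
  have h2 := bracket_pos ξ
  have h3 := bracket_pos η
  have h4 := bracket_pos (ξ - η)
  rw [← ENNReal.ofReal_pow h2.le, ← ENNReal.ofReal_pow h3.le, ← ENNReal.ofReal_pow h4.le,
    show (2 : ℝ≥0∞) = ENNReal.ofReal 2 by simp, ← ENNReal.ofReal_mul zero_le_two,
    ← ENNReal.ofReal_mul zero_le_two, ← ENNReal.ofReal_add (by positivity) (by positivity)]
  apply ENNReal.ofReal_le_ofReal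
  nlinarith [sq_nonneg (bracket η - bracket (ξ - η))]

/-- The constant of the embedding `W^{2,2} ⊂ ℱℓ¹`. -/
def embConst : ℝ≥0∞ := l2Norm fun ξ => (ebracket ξ ^ 2)⁻¹

theorem embConst_ne_top : embConst ≠ ∞ := by
  have h : ∑' ξ : Freq, ((ebracket ξ ^ 2)⁻¹) ^ 2 ≠ ∞ := by
    convert summable_bracket_inv.tsum_ofReal_ne_top with ξ
    rw [ENNReal.ofReal_inv_of_pos (by have := bracket_pos ξ; positivity),
      ENNReal.ofReal_pow (bracket_pos ξ).le, ENNReal.inv_pow, ← pow_mul, ← ENNReal.inv_pow]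
    rfl
  exact ENNReal.rpow_ne_top_of_nonneg (by norm_num) h

/-- Cauchy–Schwarz after inserting `⟨ξ⟩⁻² ⟨ξ⟩²`: in dimension two, two derivatives suffice for
absolute summability. -/
theorem tsum_le_embConst_mul (A : Freq → ℝ≥0∞) :
    ∑' ξ, A ξ ≤ embConst * l2Norm fun ξ => ebracket ξ ^ 2 * A ξ := by
  refine le_trans (le_of_eq (tsum_congr fun ξ => ?_)) (tsum_mul_le_l2Norm _ _)
  rw [← mul_assoc, ENNReal.inv_mul_cancel (pow_ne_zero 2 (ebracket_ne_zero ξ))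
    (ENNReal.pow_ne_top (ebracket_ne_top ξ)), one_mul]

variable {L : ℝ} [Fact (0 < L)]

/-! ### Sobolev norms in terms of Fourier coefficients -/

/-- The bridge to the sequence inequalities: working in `[0, ∞]`, these need no summability
hypotheses. -/
theorem sobolevNorm_eq (k : ℕ) (v : L2 L) :
    sobolevNorm k v = l2Norm fun ξ => ebracket ξ ^ k * ‖coeff v ξ‖ₑ := by
  unfold sobolevNorm l2Norm
  congr 1
  refine tsum_congr fun ξ => ?_
  rw [← bracket_sq, ENNReal.ofReal_mul (by positivity), mul_pow, ebracket,
    ← ENNReal.ofReal_pow (bracket_pos ξ).le, ← ENNReal.ofReal_pow (by have := bracket_pos ξ; positivity),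
    ← ofReal_norm, ← ENNReal.ofReal_pow (norm_nonneg _), ← pow_mul, ← pow_mul, mul_comm 2 k]

theorem sobolevNorm_zero_eq (v : L2 L) : sobolevNorm 0 v = ‖v‖ₑ := by
  have h := hasSum_norm_coeff_sq v
  rw [sobolevNorm_eq]
  have h2 : (l2Norm fun ξ => ebracket ξ ^ 0 * ‖coeff v ξ‖ₑ) ^ 2 = ‖v‖ₑ ^ 2 := by
    rw [l2Norm_sq, ← ofReal_norm v, ← ENNReal.ofReal_pow (norm_nonneg _), ← h.tsum_eq,
      ENNReal.ofReal_tsum_of_nonneg (fun _ => by positivity) h.summable]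
    refine tsum_congr fun ξ => ?_
    rw [pow_zero, one_mul, ← ofReal_norm, ← ENNReal.ofReal_pow (norm_nonneg _)]
  exact le_antisymm (le_of_sq_le_sq h2.le) (le_of_sq_le_sq h2.ge)

theorem sobolevNorm_mono {k l : ℕ} (h : k ≤ l) (v : L2 L) :
    sobolevNorm k v ≤ sobolevNorm l v := by
  rw [sobolevNorm_eq, sobolevNorm_eq]
  refine l2Norm_mono fun ξ => ?_
  gcongr
  exact one_le_ebracket ξ

theorem MemSobolev.mono {k l : ℕ} (h : k ≤ l) {v : L2 L} (hv : MemSobolev l v) :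
    MemSobolev k v := (sobolevNorm_mono h v).trans_lt hv

theorem sobolevNorm_add_le (k : ℕ) (v w : L2 L) :
    sobolevNorm k (v + w) ≤ sobolevNorm k v + sobolevNorm k w := by
  simp only [sobolevNorm_eq]
  refine le_trans (l2Norm_mono fun ξ => ?_) (l2Norm_add_le _ _)
  rw [coeff_add, ← mul_add]
  gcongr
  exact enorm_add_le _ _

theorem sobolevNorm_neg (k : ℕ) (v : L2 L) : sobolevNorm k (-v) = sobolevNorm k v := by
  simp only [sobolevNorm_eq, coeff_neg, enorm_neg]

theorem sobolevNorm_sub_le (k : ℕ) (v w : L2 L) :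
    sobolevNorm k (v - w) ≤ sobolevNorm k v + sobolevNorm k w := by
  rw [sub_eq_add_neg, ← sobolevNorm_neg k w]
  exact sobolevNorm_add_le k v (-w)

theorem MemSobolev.add {k : ℕ} {v w : L2 L} (hv : MemSobolev k v) (hw : MemSobolev k w) :
    MemSobolev k (v + w) :=
  (sobolevNorm_add_le k v w).trans_lt (ENNReal.add_lt_top.mpr ⟨hv, hw⟩)

theorem MemSobolev.sub {k : ℕ} {v w : L2 L} (hv : MemSobolev k v) (hw : MemSobolev k w) :
    MemSobolev k (v - w) :=
  (sobolevNorm_sub_le k v w).trans_lt (ENNReal.add_lt_top.mpr ⟨hv, hw⟩)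

theorem tsum_coeff_le (k : ℕ) (v : L2 L) :
    ∑' ξ, ebracket ξ ^ k * ‖coeff v ξ‖ₑ ≤ embConst * sobolevNorm (k + 2) v := by
  refine (tsum_le_embConst_mul _).trans_eq ?_
  rw [sobolevNorm_eq]
  simp only [← mul_assoc, ← pow_add, add_comm 2 k]

theorem MemSobolev.summable_coeff {v : L2 L} (hv : MemSobolev 2 v) :
    Summable fun ξ => ‖coeff v ξ‖ := by
  have h := tsum_coeff_le 0 v
  simp only [pow_zero, one_mul] at h
  have h2 : ∑' ξ, ‖coeff v ξ‖ₑ ≠ ∞ :=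
    (h.trans_lt (ENNReal.mul_lt_top embConst_ne_top.lt_top hv)).ne
  simpa using ENNReal.summable_toReal h2

/-! ### Weak derivatives -/

/-- The Fourier symbol of `∂_j`. -/
def derivSymbol (L : ℝ) (j : Fin 2) (ξ : Freq) : ℂ :=
  2 * Real.pi * Complex.I * (ξ j : ℂ) / (L : ℂ)

/-- The fundamental frequency `2 π / L`. -/
def baseFreq (L : ℝ) : ℝ := 2 * Real.pi / L

theorem baseFreq_pos : 0 < baseFreq L := by
  have : 0 < L := Fact.out
  unfold baseFreq
  positivity

theorem derivSymbol_eq {L : ℝ} (j : Fin 2) (ξ : Freq) :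
    derivSymbol L j ξ = Complex.I * baseFreq L * (ξ j : ℂ) := by
  rw [derivSymbol, baseFreq]
  push_cast
  ring

theorem norm_derivSymbol (j : Fin 2) (ξ : Freq) :
    ‖derivSymbol L j ξ‖ = baseFreq L * |(ξ j : ℝ)| := by
  rw [derivSymbol_eq]
  simp [abs_of_pos (baseFreq_pos (L := L))]

theorem enorm_derivSymbol_le (j : Fin 2) (ξ : Freq) :
    ‖derivSymbol L j ξ‖ₑ ≤ ENNReal.ofReal (baseFreq L) * ebracket ξ := by
  rw [← ofReal_norm, norm_derivSymbol, ebracket, ← ENNReal.ofReal_mul baseFreq_pos.le]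
  exact ENNReal.ofReal_le_ofReal
    (mul_le_mul_of_nonneg_left (abs_le_bracket ξ j) baseFreq_pos.le)

theorem coeff_weakDeriv {v : L2 L} (hv : MemSobolev 1 v) (j : Fin 2) (ξ : Freq) :
    coeff (weakDeriv j v) ξ = derivSymbol L j ξ * coeff v ξ := by
  -- Existence excludes the default value of `weakDeriv`; the candidate coefficients are square
  -- summable and Hermitian.
  have hex : ∃ g, HasWeakDeriv j v g := by
    refine exists_coeff_eq (fun ξ => derivSymbol L j ξ * coeff v ξ) ?_ ?_
    · have h1 : (∑' ξ, ‖derivSymbol L j ξ * coeff v ξ‖ₑ ^ 2) ≠ ∞ := by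
        rw [← l2Norm_sq]
        refine ENNReal.pow_ne_top (ne_top_of_le_ne_top (ENNReal.mul_ne_top
          (ENNReal.ofReal_ne_top (r := baseFreq L)) hv.ne) ?_)
        rw [sobolevNorm_eq, ← l2Norm_const_mul]
        refine l2Norm_mono fun ξ => ?_
        rw [enorm_mul, pow_one, ← mul_assoc]
        gcongr
        exact enorm_derivSymbol_le j ξ
      simpa using ENNReal.summable_toReal h1
    · intro ξ
      rw [coeff_neg_freq, map_mul, derivSymbol_eq, derivSymbol_eq]
      simp
  rw [weakDeriv, dif_pos hex]
  exact hex.choose_spec ξ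

theorem sobolevNorm_weakDeriv_le {k : ℕ} {v : L2 L} (hv : MemSobolev 1 v) (j : Fin 2) :
    sobolevNorm k (weakDeriv j v) ≤ ENNReal.ofReal (baseFreq L) * sobolevNorm (k + 1) v := by
  rw [sobolevNorm_eq, sobolevNorm_eq, ← l2Norm_const_mul]
  refine l2Norm_mono fun ξ => ?_
  rw [coeff_weakDeriv hv, enorm_mul, pow_succ]
  calc _ ≤ ebracket ξ ^ k * (ENNReal.ofReal (baseFreq L) * ebracket ξ * ‖coeff v ξ‖ₑ) := by
        gcongr
        exact enorm_derivSymbol_le j ξ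
    _ = _ := by ring

theorem MemSobolev.weakDeriv {k : ℕ} {v : L2 L} (hv : MemSobolev (k + 1) v) (j : Fin 2) :
    MemSobolev k (weakDeriv j v) :=
  (sobolevNorm_weakDeriv_le (hv.mono (by omega)) j).trans_lt
    (ENNReal.mul_lt_top ENNReal.ofReal_lt_top hv)

theorem coeff_divergence {u : Fin 2 → L2 L} (hu : ∀ j, MemSobolev 1 (u j)) (ξ : Freq) :
    coeff (divergence u) ξ = ∑ j, derivSymbol L j ξ * coeff (u j) ξ := by
  rw [divergence, coeff_add, coeff_weakDeriv (hu 0), coeff_weakDeriv (hu 1), Fin.sum_univ_two]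

/-! ### Products -/

/-- `W^{2,2} ⊂ L^∞` through `ℱℓ¹`, so `mul` never takes its default value in what follows. -/
theorem memLp_mul {v : L2 L} (hv : MemSobolev 2 v) (w : L2 L) :
    MemLp (fun x => (v x : ℝ) * (w x : ℝ)) 2 (torusMeasure L) := by
  refine MemLp.of_le_mul (c := ∑' ξ, ‖coeff v ξ‖) (Lp.memLp w)
    ((Lp.aestronglyMeasurable v).mul (Lp.aestronglyMeasurable w)) ?_
  filter_upwards [ae_bounded_of_summable_coeff v hv.summable_coeff] with x hx
  rw [norm_mul]
  gcongr

theorem hasSum_coeff_mul' {v : L2 L} (hv : MemSobolev 2 v) (w : L2 L) (ξ : Freq) :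
    HasSum (fun η => coeff v η * coeff w (ξ - η)) (coeff (mul v w) ξ) := by
  convert hasSum_coeff_mul v w ξ using 1
  rw [mul, dif_pos (memLp_mul hv w), coeff]
  apply integral_congr_ae
  filter_upwards [(memLp_mul hv w).coeFn_toLp] with x hx
  rw [hx]

theorem coeff_mul {v : L2 L} (hv : MemSobolev 2 v) (w : L2 L) (ξ : Freq) :
    coeff (mul v w) ξ = ∑' η, coeff v η * coeff w (ξ - η) :=
  (hasSum_coeff_mul' hv w ξ).tsum_eq.symm

theorem mul_sub_left {v v' : L2 L} (hv : MemSobolev 2 v) (hv' : MemSobolev 2 v') (w : L2 L) :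
    mul (v - v') w = mul v w - mul v' w := by
  refine coeff_injective fun ξ => ?_
  rw [coeff_sub]
  refine (hasSum_coeff_mul' (hv.sub hv') w ξ).unique ?_
  simpa only [coeff_sub, sub_mul] using (hasSum_coeff_mul' hv w ξ).sub (hasSum_coeff_mul' hv' w ξ)

theorem mul_sub_right {v : L2 L} (hv : MemSobolev 2 v) (w w' : L2 L) :
    mul v (w - w') = mul v w - mul v w' := by
  refine coeff_injective fun ξ => ?_
  rw [coeff_sub]
  refine (hasSum_coeff_mul' hv _ ξ).unique ?_
  simpa only [coeff_sub, mul_sub] using (hasSum_coeff_mul' hv w ξ).sub (hasSum_coeff_mul' hv w' ξ)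

theorem enorm_coeff_mul_le {v : L2 L} (hv : MemSobolev 2 v) (w : L2 L) (ξ : Freq) :
    ‖coeff (mul v w) ξ‖ₑ ≤ conv (fun η => ‖coeff v η‖ₑ) (fun η => ‖coeff w η‖ₑ) ξ := by
  rw [coeff_mul hv]
  refine (enorm_tsum_le_tsum_enorm ).trans_eq ?_
  simp only [enorm_mul, conv]

/-- The derivative is shared out by `⟨ξ⟩ ≤ ⟨η⟩ + ⟨ξ - η⟩`. In both terms `w` is the factor put in
`ℓ¹`, which is why only the `W^{1,2}` norm of `v` appears. -/
theorem sobolevNorm_one_mul_le {v : L2 L} (hv : MemSobolev 2 v) (w : L2 L) :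
    sobolevNorm 1 (mul v w) ≤ 2 * embConst * sobolevNorm 1 v * sobolevNorm 3 w := by
  have h1 : sobolevNorm 1 (mul v w) ≤
      l2Norm (fun ξ => conv (fun η => ebracket η ^ 1 * ‖coeff v η‖ₑ) (fun η => ‖coeff w η‖ₑ) ξ +
        conv (fun η => ‖coeff v η‖ₑ) (fun η => ebracket η ^ 1 * ‖coeff w η‖ₑ) ξ) := by
    rw [sobolevNorm_eq]
    refine l2Norm_mono fun ξ => ?_
    refine (mul_le_mul_right (enorm_coeff_mul_le hv w ξ) _).trans ?_
    rw [conv, conv, conv, ← ENNReal.tsum_mul_left, ← ENNReal.tsum_add]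
    refine ENNReal.tsum_le_tsum fun η => ?_
    calc _ ≤ (ebracket η + ebracket (ξ - η)) * (‖coeff v η‖ₑ * ‖coeff w (ξ - η)‖ₑ) := by
          rw [pow_one]
          gcongr
          exact ebracket_le_add ξ η
      _ = _ := by ring
  refine (h1.trans (l2Norm_add_le _ _)).trans ?_
  have h2 := tsum_coeff_le 0 w
  have h3 := tsum_coeff_le 1 w
  have h4 := sobolevNorm_mono (show 0 ≤ 1 by omega) v
  have h5 := sobolevNorm_mono (show 2 ≤ 3 by omega) w
  simp only [pow_zero, one_mul, zero_add] at h2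
  calc _ ≤ sobolevNorm 1 v * (embConst * sobolevNorm 2 w) +
        sobolevNorm 0 v * (embConst * sobolevNorm 3 w) := by
        gcongr
        · refine (l2Norm_conv_le _ _).trans ?_
          rw [sobolevNorm_eq 1 v]
          gcongr
        · refine (l2Norm_conv_le _ _).trans ?_
          simp only [sobolevNorm_eq 0 v, pow_zero, one_mul]
          gcongr
    _ ≤ sobolevNorm 1 v * (embConst * sobolevNorm 3 w) +
        sobolevNorm 1 v * (embConst * sobolevNorm 3 w) := by gcongr
    _ = _ := by ring

theorem MemSobolev.mul {v : L2 L} (hv : MemSobolev 2 v) {w : L2 L} (hw : MemSobolev 3 w) :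
    MemSobolev 1 (TQG.mul v w) :=
  (sobolevNorm_one_mul_le hv w).trans_lt (ENNReal.mul_lt_top (ENNReal.mul_lt_top
    (ENNReal.mul_lt_top (by simp) embConst_ne_top.lt_top) (hv.mono one_le_two)) hw)

/-- The sum of the `W^{3,2}` norms of the components of a vector field. -/
def velNorm (u : Fin 2 → L2 L) : ℝ≥0∞ := ∑ j, sobolevNorm 3 (u j)

theorem weakDeriv_sub {v w : L2 L} (hv : MemSobolev 1 v) (hw : MemSobolev 1 w) (j : Fin 2) :
    weakDeriv j (v - w) = weakDeriv j v - weakDeriv j w := by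
  refine coeff_injective fun ξ => ?_
  rw [coeff_sub, coeff_weakDeriv hv, coeff_weakDeriv hw, coeff_weakDeriv (hv.sub hw), coeff_sub]
  ring

theorem divergence_sub {u u' : Fin 2 → L2 L} (hu : ∀ j, MemSobolev 1 (u j))
    (hu' : ∀ j, MemSobolev 1 (u' j)) :
    divergence (u - u') = divergence u - divergence u' := by
  simp only [divergence, Pi.sub_apply, weakDeriv_sub (hu _) (hu' _)]
  abel

theorem enorm_divergence_mulVec_le {v : L2 L} (hv : MemSobolev 2 v) {u : Fin 2 → L2 L}
    (hu : ∀ j, MemSobolev 3 (u j)) :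
    ‖divergence (mulVec v u)‖ₑ ≤
      ENNReal.ofReal (baseFreq L) * (2 * embConst * sobolevNorm 1 v * velNorm u) := by
  have h : ∀ j, sobolevNorm 0 (weakDeriv j (mul v (u j))) ≤
      ENNReal.ofReal (baseFreq L) * (2 * embConst * sobolevNorm 1 v * sobolevNorm 3 (u j)) :=
    fun j => (sobolevNorm_weakDeriv_le (hv.mul (hu j)) j).trans
      (mul_le_mul_right (sobolevNorm_one_mul_le hv _) _)
  rw [← sobolevNorm_zero_eq, divergence, velNorm, Fin.sum_univ_two, mul_add, mul_add]
  exact (sobolevNorm_add_le _ _ _).trans (add_le_add (h 0) (h 1))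

theorem divergence_mulVec_sub {v v' : L2 L} (hv : MemSobolev 2 v) (hv' : MemSobolev 2 v')
    {u u' : Fin 2 → L2 L} (hu : ∀ j, MemSobolev 3 (u j)) (hu' : ∀ j, MemSobolev 3 (u' j)) :
    divergence (mulVec v u) - divergence (mulVec v' u') =
      divergence (mulVec (v - v') u) + divergence (mulVec v' (u - u')) := by
  have h1 : mulVec (v - v') u = mulVec v u - mulVec v' u := by
    ext1 j
    exact mul_sub_left hv hv' (u j)
  have h2 : mulVec v' (u - u') = mulVec v' u - mulVec v' u' := by
    ext1 j
    exact mul_sub_right hv' (u j) (u' j)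
  have m1 : ∀ j, MemSobolev 1 (mulVec v u j) := fun j => hv.mul (hu j)
  have m2 : ∀ j, MemSobolev 1 (mulVec v' u j) := fun j => hv'.mul (hu j)
  have m3 : ∀ j, MemSobolev 1 (mulVec v' u' j) := fun j => hv'.mul (hu' j)
  rw [h1, h2, divergence_sub m1 m2, divergence_sub m2 m3]
  abel

/-! ### Transport by a divergence-free vector field -/

/-- The vector field `u` is divergence free, in terms of Fourier coefficients. -/
def DivFree (u : Fin 2 → L2 L) : Prop := ∀ ξ : Freq, ∑ j, (ξ j : ℂ) * coeff (u j) ξ = 0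

/-- The kernel `ξ ⬝ û(ξ - η)` of the transport operator. -/
def transportKernel (u : Fin 2 → L2 L) (ξ η : Freq) : ℂ := ∑ j, (ξ j : ℂ) * coeff (u j) (ξ - η)

/-- The sum of the moduli of the Fourier coefficients of the components of `u`. -/
def speed (u : Fin 2 → L2 L) (ξ : Freq) : ℝ≥0∞ := ∑ j, ‖coeff (u j) ξ‖ₑ

theorem speed_neg (u : Fin 2 → L2 L) (ξ : Freq) : speed u (-ξ) = speed u ξ := by
  simp only [speed, coeff_neg_freq, RCLike.enorm_conj]

theorem l2Norm_speed_le {k : ℕ} (hk : k ≤ 3) (u : Fin 2 → L2 L) :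
    l2Norm (fun ξ => ebracket ξ ^ k * speed u ξ) ≤ velNorm u := by
  simp only [speed, velNorm, Fin.sum_univ_two, mul_add]
  refine (l2Norm_add_le _ _).trans ?_
  rw [← sobolevNorm_eq, ← sobolevNorm_eq]
  exact add_le_add (sobolevNorm_mono hk _) (sobolevNorm_mono hk _)

theorem tsum_speed_le {k : ℕ} (hk : k ≤ 1) (u : Fin 2 → L2 L) :
    ∑' ξ, ebracket ξ ^ k * speed u ξ ≤ embConst * velNorm u := by
  refine (tsum_le_embConst_mul _).trans ?_
  gcongr
  simp only [← mul_assoc, ← pow_add]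
  exact l2Norm_speed_le (by omega) u

/-- The difference of the two kernels is `(ξ - η) ⬝ û(ξ - η) = 0`; this is `div(v u) = u ⬝ ∇v`. -/
theorem DivFree.transportKernel_eq {u : Fin 2 → L2 L} (hu : DivFree u) (ξ η : Freq) :
    transportKernel u ξ η = ∑ j, (η j : ℂ) * coeff (u j) (ξ - η) := by
  have := hu (ξ - η)
  rw [← sub_eq_zero, transportKernel, ← Finset.sum_sub_distrib, ← this]
  refine Finset.sum_congr rfl fun j _ => ?_
  simp only [Pi.sub_apply, Int.cast_sub]
  ring

/-- The kernel is Hermitian because `u` is real and divergence free; multiplied by `i` it becomes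
skew, which is the `L²` skew-adjointness of transport. -/
theorem DivFree.transportKernel_swap {u : Fin 2 → L2 L} (hu : DivFree u) (ξ η : Freq) :
    transportKernel u η ξ = conj (transportKernel u ξ η) := by
  rw [hu.transportKernel_eq ξ η, transportKernel, map_sum]
  refine Finset.sum_congr rfl fun j _ => ?_
  rw [map_mul, ← coeff_neg_freq, neg_sub]
  simp

/-- The modulus `|ξ|` of a frequency. -/
def absFreq (ξ : Freq) : ℝ≥0∞ := ENNReal.ofReal √(∑ j, (ξ j : ℝ) ^ 2)

theorem absFreq_le_ebracket (ξ : Freq) : absFreq ξ ≤ ebracket ξ :=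
  ENNReal.ofReal_le_ofReal (Real.sqrt_le_sqrt (by linarith))

theorem enorm_intCast_le_absFreq (ξ : Freq) (j : Fin 2) : ‖(ξ j : ℂ)‖ₑ ≤ absFreq ξ := by
  rw [← ofReal_norm, Complex.norm_intCast, absFreq, ← Real.sqrt_sq_eq_abs]
  exact ENNReal.ofReal_le_ofReal (Real.sqrt_le_sqrt
    (Finset.single_le_sum (f := fun j => (ξ j : ℝ) ^ 2) (fun i _ => sq_nonneg _)
      (Finset.mem_univ j)))

theorem enorm_transportKernel_le (u : Fin 2 → L2 L) (ξ η : Freq) :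
    ‖transportKernel u ξ η‖ₑ ≤ absFreq ξ * speed u (ξ - η) := by
  rw [transportKernel, speed, Finset.mul_sum]
  refine (enorm_sum_le _ _).trans (Finset.sum_le_sum fun j _ => ?_)
  rw [enorm_mul]
  gcongr
  exact enorm_intCast_le_absFreq ξ j

theorem DivFree.enorm_transportKernel_le {u : Fin 2 → L2 L} (hu : DivFree u) (ξ η : Freq) :
    ‖transportKernel u ξ η‖ₑ ≤ absFreq η * speed u (ξ - η) := by
  rw [← RCLike.enorm_conj, ← hu.transportKernel_swap, ← speed_neg, neg_sub]
  exact TQG.enorm_transportKernel_le u η ξ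

theorem hasSum_coeff_divergence_mulVec {v : L2 L} (hv : MemSobolev 2 v) {u : Fin 2 → L2 L}
    (hu : ∀ j, MemSobolev 3 (u j)) (ξ : Freq) :
    HasSum (fun η => Complex.I * baseFreq L * (coeff v η * transportKernel u ξ η))
      (coeff (divergence (mulVec v u)) ξ) := by
  have hm : ∀ j, MemSobolev 1 (mulVec v u j) := fun j => hv.mul (hu j)
  rw [coeff_divergence hm]
  have key : HasSum (fun η => ∑ j, derivSymbol L j ξ * (coeff v η * coeff (u j) (ξ - η)))
      (∑ j, derivSymbol L j ξ * coeff (mulVec v u j) ξ) :=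
    hasSum_sum fun j _ => (hasSum_coeff_mul' hv (u j) ξ).mul_left (derivSymbol L j ξ)
  refine key.congr_fun fun η => ?_
  rw [transportKernel, Finset.mul_sum, Finset.mul_sum]
  refine Finset.sum_congr rfl fun j _ => ?_
  rw [derivSymbol_eq]
  ring

theorem enorm_coeff_divergence_mulVec_le {v : L2 L} (hv : MemSobolev 2 v) {u : Fin 2 → L2 L}
    (hu : ∀ j, MemSobolev 3 (u j)) (hdiv : DivFree u) (ξ : Freq) :
    ‖coeff (divergence (mulVec v u)) ξ‖ₑ ≤
      ENNReal.ofReal (baseFreq L) * conv (fun η => absFreq η * ‖coeff v η‖ₑ) (speed u) ξ := by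
  rw [← (hasSum_coeff_divergence_mulVec hv hu ξ).tsum_eq, conv, ← ENNReal.tsum_mul_left]
  refine enorm_tsum_le_tsum_enorm.trans (ENNReal.tsum_le_tsum fun η => ?_)
  rw [enorm_mul, enorm_mul, enorm_mul, mul_assoc (absFreq η), mul_left_comm (absFreq η)]
  gcongr
  · rw [← ofReal_norm, ← ofReal_norm, Complex.norm_I, Complex.norm_real, Real.norm_eq_abs,
      abs_of_pos baseFreq_pos]
    simp
  · exact hdiv.enorm_transportKernel_le ξ η

/-- The `L²` norm of the gradient, up to the factor `2 π / L`. -/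
def gradNorm (v : L2 L) : ℝ≥0∞ := l2Norm fun ξ => absFreq ξ * ‖coeff v ξ‖ₑ

/-- The derivative falls entirely on `v`, with `û` in `ℓ¹`. Applied to `b`, this is the source of
the quantity `‖∇b‖` in the blow-up criterion. -/
theorem sobolevNorm_zero_transport_le {v : L2 L} (hv : MemSobolev 2 v) {u : Fin 2 → L2 L}
    (hu : ∀ j, MemSobolev 3 (u j)) (hdiv : DivFree u) :
    sobolevNorm 0 (divergence (mulVec v u)) ≤
      ENNReal.ofReal (baseFreq L) * embConst * gradNorm v * velNorm u := by
  have h := tsum_speed_le (k := 0) (by omega) u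
  simp only [pow_zero, one_mul] at h
  calc _ ≤ l2Norm (fun ξ => ENNReal.ofReal (baseFreq L) *
        conv (fun η => absFreq η * ‖coeff v η‖ₑ) (speed u) ξ) := by
        rw [sobolevNorm_eq]
        refine l2Norm_mono fun ξ => ?_
        rw [pow_zero, one_mul]
        exact enorm_coeff_divergence_mulVec_le hv hu hdiv ξ
    _ ≤ ENNReal.ofReal (baseFreq L) * (gradNorm v * (embConst * velNorm u)) := by
        rw [l2Norm_const_mul]
        gcongr
        refine (l2Norm_conv_le _ _).trans ?_
        rw [gradNorm]
        gcongr
    _ = _ := by ring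

/-- The weight `⟨ξ⟩²` goes either to `v`, leaving `û` in `ℓ¹`, or to `u`, leaving the gradient of
`v` in `ℓ¹`, which costs `W^{3,2}`. -/
theorem sobolevNorm_two_transport_le {v : L2 L} (hv : MemSobolev 2 v) {u : Fin 2 → L2 L}
    (hu : ∀ j, MemSobolev 3 (u j)) (hdiv : DivFree u) :
    sobolevNorm 2 (divergence (mulVec v u)) ≤
      4 * ENNReal.ofReal (baseFreq L) * embConst * sobolevNorm 3 v * velNorm u := by
  have h := tsum_speed_le (k := 0) (by omega) u
  simp only [pow_zero, one_mul] at h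
  calc _ ≤ l2Norm (fun ξ => (2 * ENNReal.ofReal (baseFreq L)) *
        (conv (fun η => ebracket η ^ 3 * ‖coeff v η‖ₑ) (speed u) ξ +
          conv (fun η => ebracket η ^ 1 * ‖coeff v η‖ₑ)
            (fun ζ => ebracket ζ ^ 2 * speed u ζ) ξ)) := by
        rw [sobolevNorm_eq]
        refine l2Norm_mono fun ξ => ?_
        refine (mul_le_mul_right (enorm_coeff_divergence_mulVec_le hv hu hdiv ξ) _).trans ?_
        rw [mul_left_comm, mul_comm 2, mul_assoc]
        refine mul_le_mul_right ?_ _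
        simp only [conv, ← ENNReal.tsum_mul_left, ← ENNReal.tsum_add]
        refine ENNReal.tsum_le_tsum fun η => ?_
        calc _ ≤ (2 * ebracket η ^ 2 + 2 * ebracket (ξ - η) ^ 2) *
              (ebracket η * ‖coeff v η‖ₑ * speed u (ξ - η)) := by
              gcongr
              · exact ebracket_sq_le ξ η
              · exact absFreq_le_ebracket η
          _ = _ := by ring
    _ ≤ (2 * ENNReal.ofReal (baseFreq L)) * (sobolevNorm 3 v * (embConst * velNorm u) +
          (embConst * sobolevNorm 3 v) * velNorm u) := by
        rw [l2Norm_const_mul]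
        gcongr
        refine (l2Norm_add_le _ _).trans ?_
        gcongr
        · refine (l2Norm_conv_le _ _).trans ?_
          rw [sobolevNorm_eq 3 v]
          gcongr
        · refine (l2Norm_conv_le' _ _).trans ?_
          gcongr
          · exact tsum_coeff_le 1 v
          · exact l2Norm_speed_le (by omega) u
    _ = _ := by ring

/-! ### Weighted energy pairings and the commutator estimate. -/

/-- Cauchy–Schwarz for a weighted Fourier pairing. -/
theorem enorm_sum_weight_le (k : ℕ) (v F : L2 L) (S : Finset Freq) (w : Freq → ℝ)
    (hw : ∀ ξ, |w ξ| ≤ bracket ξ ^ (2 * k)) :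
    ‖∑ ξ ∈ S, w ξ * (conj (coeff v ξ) * coeff F ξ).re‖ₑ ≤ sobolevNorm k v * sobolevNorm k F := by
  rw [sobolevNorm_eq, sobolevNorm_eq]
  refine (enorm_sum_le _ _).trans ((ENNReal.sum_le_tsum S).trans
    (le_trans (ENNReal.tsum_le_tsum fun ξ => ?_) (tsum_mul_le_l2Norm _ _)))
  have h1 : ‖w ξ‖ₑ ≤ ebracket ξ ^ k * ebracket ξ ^ k := by
    rw [← pow_add, ← two_mul, ebracket, ← ENNReal.ofReal_pow (bracket_pos ξ).le, ← ofReal_norm]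
    exact ENNReal.ofReal_le_ofReal (hw ξ)
  have h2 : ‖(conj (coeff v ξ) * coeff F ξ).re‖ₑ ≤ ‖coeff v ξ‖ₑ * ‖coeff F ξ‖ₑ := by
    rw [← RCLike.enorm_conj (coeff v ξ), ← enorm_mul, ← ofReal_norm, ← ofReal_norm]
    exact ENNReal.ofReal_le_ofReal (Complex.abs_re_le_norm _)
  calc _ ≤ ebracket ξ ^ k * ebracket ξ ^ k * (‖coeff v ξ‖ₑ * ‖coeff F ξ‖ₑ) := by
        rw [enorm_mul]
        gcongr
    _ = _ := by ring

/-- The weighted sum of an antisymmetric kernel only sees the increments of the weight. -/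
theorem enorm_two_mul_sum_antisymm_le (S : Finset Freq) (w : Freq → ℝ) (hw : ∀ ξ ∉ S, w ξ = 0)
    (K : Freq → Freq → ℝ) (hK : ∀ ξ, Summable (K ξ)) (hanti : ∀ ξ η, K η ξ = -K ξ η) :
    ‖2 * ∑ ξ ∈ S, w ξ * ∑' η, K ξ η‖ₑ ≤ ∑' ξ, ∑' η, ‖w ξ - w η‖ₑ * ‖K ξ η‖ₑ := by
  -- Only finitely many rows carry weight, so row summability of `K` gives absolute summability on
  -- the product.
  have hsum : Summable fun p : Freq × Freq => w p.1 * K p.1 p.2 := by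
    apply Summable.of_norm
    rw [summable_prod_of_nonneg fun _ => norm_nonneg _]
    refine ⟨fun ξ => ((hK ξ).mul_left (w ξ)).norm,
      summable_of_ne_finset_zero (s := S) fun ξ hξ => ?_⟩
    simp [hw ξ hξ]
  have h1 : ∑' p : Freq × Freq, w p.1 * K p.1 p.2 = ∑ ξ ∈ S, w ξ * ∑' η, K ξ η := by
    rw [hsum.tsum_prod, tsum_eq_sum (s := S)]
    · simp only [tsum_mul_left]
    · intro ξ hξ
      simp [hw ξ hξ]
  have hsum' : Summable fun p : Freq × Freq => w p.2 * K p.1 p.2 := by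
    have := (hsum.comp_injective (Equiv.prodComm Freq Freq).injective).neg
    refine this.congr fun p => ?_
    simp only [Function.comp_apply, Equiv.prodComm_apply, Prod.fst_swap, Prod.snd_swap]
    rw [hanti p.1 p.2]
    ring
  -- Exchanging the two frequencies flips the sign, so twice the pairing is the sum against `w ξ - w
  -- η`.
  have h2 : ∑' p : Freq × Freq, w p.2 * K p.1 p.2 = -∑' p : Freq × Freq, w p.1 * K p.1 p.2 := by
    rw [← (Equiv.prodComm Freq Freq).tsum_eq (fun p : Freq × Freq => w p.1 * K p.1 p.2), ← tsum_neg]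
    refine tsum_congr fun p => ?_
    simp only [Equiv.prodComm_apply, Prod.fst_swap, Prod.snd_swap]
    rw [hanti p.1 p.2]
    ring
  have h3 : 2 * ∑ ξ ∈ S, w ξ * ∑' η, K ξ η =
      ∑' p : Freq × Freq, (w p.1 - w p.2) * K p.1 p.2 := by
    simp only [sub_mul]
    rw [hsum.tsum_sub hsum', h2, h1]
    ring
  rw [h3]
  refine enorm_tsum_le_tsum_enorm.trans_eq ?_
  rw [ENNReal.tsum_prod']
  simp only [enorm_mul]

/-- The difference of powers is at most `2k z b^(2k-1)`. The extra factor `a` and the surplus powers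
of `b` are traded for `a` and `z` through `b ≤ a + z`. Only `z` and `z³` result: the powers for
which `W^{3,2}` controls `û` in `ℓ¹` and in `ℓ²` respectively. -/
theorem bracket_commutator_aux {a b z : ℝ} (ha : 1 ≤ a) (hab : a ≤ b) (hb : b ≤ a + z) {k : ℕ}
    (hk : k = 2 ∨ k = 3) :
    (b ^ (2 * k) - a ^ (2 * k)) * a ≤ 12 * (a ^ k * b ^ k * z + a ^ (k - 2) * b ^ k * z ^ 3) := by
  have hz : b - a ≤ z := by linarith
  have h0 : 0 ≤ b - a := by linarith
  have hz0 : 0 ≤ z := h0.trans hz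
  have ha0 : 0 < a := by linarith
  have hb0 : 0 < b := by linarith
  rcases hk with rfl | rfl
  · have h1 : b ^ (2 * 2) - a ^ (2 * 2) ≤ 4 * z * b ^ 3 := by
      have e : b ^ (2 * 2) - a ^ (2 * 2) = (b - a) * ((b + a) * (b ^ 2 + a ^ 2)) := by ring
      rw [e]
      calc _ ≤ z * ((b + b) * (b ^ 2 + b ^ 2)) := by gcongr
        _ = _ := by ring
    have h2 : b * a ≤ 2 * (a ^ 2 + z ^ 2) := by nlinarith [sq_nonneg (a - z)]
    calc _ ≤ 4 * z * b ^ 3 * a := by gcongr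
      _ = 4 * z * b ^ 2 * (b * a) := by ring
      _ ≤ 4 * z * b ^ 2 * (2 * (a ^ 2 + z ^ 2)) := by gcongr
      _ ≤ 12 * z * b ^ 2 * (a ^ 2 + z ^ 2) := by
        have : 0 ≤ z * b ^ 2 * (a ^ 2 + z ^ 2) := by positivity
        linarith
      _ = _ := by ring
  · have h1 : b ^ (2 * 3) - a ^ (2 * 3) ≤ 6 * z * b ^ 5 := by
      have e : b ^ (2 * 3) - a ^ (2 * 3) =
        (b - a) * ((b + a) * (b ^ 4 + b ^ 2 * a ^ 2 + a ^ 4)) := by ring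
      rw [e]
      calc _ ≤ z * ((b + b) * (b ^ 4 + b ^ 2 * b ^ 2 + b ^ 4)) := by gcongr
        _ = _ := by ring
    have h2 : b ^ 2 ≤ 2 * (a ^ 2 + z ^ 2) := by nlinarith [sq_nonneg (a - z)]
    calc _ ≤ 6 * z * b ^ 5 * a := by gcongr
      _ = 6 * z * b ^ 3 * a * b ^ 2 := by ring
      _ ≤ 6 * z * b ^ 3 * a * (2 * (a ^ 2 + z ^ 2)) := by gcongr
      _ = _ := by ring

theorem bracket_commutator {a b z : ℝ} (ha : 1 ≤ a) (hb : 1 ≤ b) (hz : 0 ≤ z) (h1 : a ≤ b + z)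
    (h2 : b ≤ a + z) {k : ℕ} (hk : k = 2 ∨ k = 3) :
    |a ^ (2 * k) - b ^ (2 * k)| * min a b ≤
      12 * (a ^ k * b ^ k * z + a ^ k * b ^ (k - 2) * z ^ 3 + a ^ (k - 2) * b ^ k * z ^ 3) := by
  rcases le_total a b with hab | hab
  · have h := bracket_commutator_aux ha hab h2 hk
    rw [abs_sub_comm, abs_of_nonneg (sub_nonneg.mpr (by gcongr)), min_eq_left hab]
    have : 0 ≤ a ^ k * b ^ (k - 2) * z ^ 3 := by positivity
    linarith
  · have h := bracket_commutator_aux hb hab h1 hk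
    rw [abs_of_nonneg (sub_nonneg.mpr (by gcongr)), min_eq_right hab]
    have : 0 ≤ a ^ (k - 2) * b ^ k * z ^ 3 := by positivity
    linarith

theorem ebracket_commutator {k : ℕ} (hk : k = 2 ∨ k = 3) (ξ η : Freq) :
    ENNReal.ofReal |bracket ξ ^ (2 * k) - bracket η ^ (2 * k)| * min (ebracket ξ) (ebracket η) ≤
      12 * (ebracket ξ ^ k * ebracket η ^ k * ebracket (ξ - η) +
        ebracket ξ ^ k * ebracket η ^ (k - 2) * ebracket (ξ - η) ^ 3 +
        ebracket ξ ^ (k - 2) * ebracket η ^ k * ebracket (ξ - η) ^ 3) := by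
  have ha := bracket_pos ξ
  have hb := bracket_pos η
  have hz := bracket_pos (ξ - η)
  have h1 : bracket ξ ≤ bracket η + bracket (ξ - η) := by
    simpa using bracket_add_le η (ξ - η)
  have h2 : bracket η ≤ bracket ξ + bracket (ξ - η) := by
    have := bracket_add_le ξ (η - ξ)
    rwa [add_sub_cancel, ← neg_sub ξ η, bracket_neg] at this
  have h := ENNReal.ofReal_le_ofReal
    (bracket_commutator (one_le_bracket ξ) (one_le_bracket η) hz.le h1 h2 hk)
  rw [ENNReal.ofReal_mul (abs_nonneg _), ENNReal.ofReal_min, ENNReal.ofReal_mul (by norm_num),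
    ENNReal.ofReal_add (by positivity) (by positivity),
    ENNReal.ofReal_add (by positivity) (by positivity), ENNReal.ofReal_mul (by positivity),
    ENNReal.ofReal_mul (by positivity), ENNReal.ofReal_mul (by positivity),
    ENNReal.ofReal_mul (by positivity), ENNReal.ofReal_mul (by positivity),
    ENNReal.ofReal_mul (by positivity), ENNReal.ofReal_pow ha.le, ENNReal.ofReal_pow ha.le,
    ENNReal.ofReal_pow hb.le, ENNReal.ofReal_pow hb.le, ENNReal.ofReal_pow hz.le] at h
  simpa only [ebracket, ENNReal.ofReal_ofNat] using h

/-- The trilinear form controlling the commutator of a Sobolev weight with transport. -/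
theorem tsum_trilinear_le (k : ℕ) (hk : 2 ≤ k) (v : L2 L) (u : Fin 2 → L2 L) :
    ∑' ξ, ∑' η, (ebracket ξ ^ k * ebracket η ^ k * ebracket (ξ - η) +
        ebracket ξ ^ k * ebracket η ^ (k - 2) * ebracket (ξ - η) ^ 3 +
        ebracket ξ ^ (k - 2) * ebracket η ^ k * ebracket (ξ - η) ^ 3) *
          (‖coeff v ξ‖ₑ * ‖coeff v η‖ₑ * speed u (ξ - η)) ≤
      3 * (embConst * sobolevNorm k v ^ 2 * velNorm u) := by
  set A : Freq → ℝ≥0∞ := fun ξ => ebracket ξ ^ k * ‖coeff v ξ‖ₑ with hA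
  set A' : Freq → ℝ≥0∞ := fun ξ => ebracket ξ ^ (k - 2) * ‖coeff v ξ‖ₑ with hA'
  set U : Freq → ℝ≥0∞ := fun ξ => ebracket ξ ^ 1 * speed u ξ with hU
  set U' : Freq → ℝ≥0∞ := fun ξ => ebracket ξ ^ 3 * speed u ξ with hU'
  have e : ∀ ξ, ∑' η, (ebracket ξ ^ k * ebracket η ^ k * ebracket (ξ - η) +
        ebracket ξ ^ k * ebracket η ^ (k - 2) * ebracket (ξ - η) ^ 3 +
        ebracket ξ ^ (k - 2) * ebracket η ^ k * ebracket (ξ - η) ^ 3) *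
          (‖coeff v ξ‖ₑ * ‖coeff v η‖ₑ * speed u (ξ - η)) =
      A ξ * conv A U ξ + A ξ * conv A' U' ξ + A' ξ * conv A U' ξ := by
    intro ξ
    simp only [conv, ← ENNReal.tsum_mul_left, ← ENNReal.tsum_add]
    refine tsum_congr fun η => ?_
    simp only [hA, hA', hU, hU']
    ring
  have nA : l2Norm A = sobolevNorm k v := (sobolevNorm_eq k v).symm
  have nA' : ∑' ξ, A' ξ ≤ embConst * sobolevNorm k v := by
    have := tsum_coeff_le (k - 2) v
    rwa [Nat.sub_add_cancel hk] at this
  have nU : ∑' ξ, U ξ ≤ embConst * velNorm u := tsum_speed_le le_rfl u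
  have nU' : l2Norm U' ≤ velNorm u := l2Norm_speed_le le_rfl u
  have hneg : (fun ζ => U' (-ζ)) = U' := by
    ext ζ
    simp only [hU', ebracket_neg, speed_neg]
  simp only [e, ENNReal.tsum_add]
  -- In the third term the lightly weighted factor `A'` stands outside; after the swap it is the
  -- `ℓ¹` factor, exactly as in the second term.
  rw [tsum_mul_conv_swap A' A U', hneg]
  calc _ ≤ sobolevNorm k v * sobolevNorm k v * (embConst * velNorm u) +
      sobolevNorm k v * (embConst * sobolevNorm k v) * velNorm u +
      sobolevNorm k v * (embConst * sobolevNorm k v) * velNorm u := by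
        gcongr
        · exact (tsum_mul_conv_le A A U).trans (by rw [nA]; gcongr)
        · exact (tsum_mul_conv_le' A A' U').trans (by rw [nA]; gcongr)
        · exact (tsum_mul_conv_le' A A' U').trans (by rw [nA]; gcongr)
    _ = _ := by ring

/-- The transport term in a weighted energy estimate loses no derivative. -/
theorem enorm_transport_energy_le {k : ℕ} (hk : k = 2 ∨ k = 3) {v : L2 L} (hv : MemSobolev 2 v)
    {u : Fin 2 → L2 L} (hu : ∀ j, MemSobolev 3 (u j)) (hdiv : DivFree u) (S : Finset Freq)
    (w : Freq → ℝ) (hw : ∀ ξ ∉ S, w ξ = 0) {δ : ℝ} (hδ : 0 ≤ δ)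
    (hdiff : ∀ ξ η, |w ξ - w η| ≤ δ * |bracket ξ ^ (2 * k) - bracket η ^ (2 * k)|) :
    ‖2 * ∑ ξ ∈ S, w ξ * (conj (coeff v ξ) * coeff (divergence (mulVec v u)) ξ).re‖ₑ ≤
      36 * ENNReal.ofReal (baseFreq L) * embConst * ENNReal.ofReal δ *
        sobolevNorm k v ^ 2 * velNorm u := by
  set K : Freq → Freq → ℝ := fun ξ η =>
    (conj (coeff v ξ) * (Complex.I * baseFreq L * (coeff v η * transportKernel u ξ η))).re with hKdef
  have hK : ∀ ξ, HasSum (K ξ) (conj (coeff v ξ) * coeff (divergence (mulVec v u)) ξ).re := fun ξ =>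
    Complex.hasSum_re ((hasSum_coeff_divergence_mulVec hv hu ξ).mul_left _)
  -- The real part of `i` times a Hermitian kernel is antisymmetric.
  have hanti : ∀ ξ η, K η ξ = -K ξ η := by
    intro ξ η
    simp only [hKdef]
    rw [hdiv.transportKernel_swap ξ η, ← Complex.conj_re, ← Complex.neg_re]
    congr 1
    simp only [map_mul, Complex.conj_conj, Complex.conj_I, Complex.conj_ofReal]
    ring
  have hbound : ∀ ξ η, ‖K ξ η‖ₑ ≤ ENNReal.ofReal (baseFreq L) * (min (ebracket ξ) (ebracket η) *
      (‖coeff v ξ‖ₑ * ‖coeff v η‖ₑ * speed u (ξ - η))) := by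
    intro ξ η
    have h1 : ‖K ξ η‖ₑ ≤
        ‖conj (coeff v ξ) * (Complex.I * baseFreq L * (coeff v η * transportKernel u ξ η))‖ₑ := by
      rw [← ofReal_norm, ← ofReal_norm]
      exact ENNReal.ofReal_le_ofReal (Complex.abs_re_le_norm _)
    -- Divergence-freeness allows the derivative to be charged to the smaller of the two
    -- frequencies.
    have h2 : ‖transportKernel u ξ η‖ₑ ≤ min (ebracket ξ) (ebracket η) * speed u (ξ - η) := by
      rcases min_choice (ebracket ξ) (ebracket η) with h | h <;> rw [h]
      · exact (enorm_transportKernel_le u ξ η).trans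
          (mul_le_mul_left (absFreq_le_ebracket ξ) _)
      · exact (hdiv.enorm_transportKernel_le ξ η).trans
          (mul_le_mul_left (absFreq_le_ebracket η) _)
    have h3 : ‖Complex.I * (baseFreq L : ℂ)‖ₑ = ENNReal.ofReal (baseFreq L) := by
      rw [← ofReal_norm, norm_mul, Complex.norm_I, Complex.norm_real, Real.norm_eq_abs,
        abs_of_pos baseFreq_pos, one_mul]
    refine h1.trans ?_
    rw [enorm_mul, enorm_mul (Complex.I * (baseFreq L : ℂ)), enorm_mul (coeff v η), h3, RCLike.enorm_conj]
    calc _ ≤ ‖coeff v ξ‖ₑ * (ENNReal.ofReal (baseFreq L) * (‖coeff v η‖ₑ *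
          (min (ebracket ξ) (ebracket η) * speed u (ξ - η)))) := by gcongr
      _ = _ := by ring
  have hmain := enorm_two_mul_sum_antisymm_le S w hw K (fun ξ => (hK ξ).summable) hanti
  simp only [fun ξ => (hK ξ).tsum_eq] at hmain
  refine hmain.trans ?_
  have hpt : ∀ ξ η, ‖w ξ - w η‖ₑ * ‖K ξ η‖ₑ ≤
      12 * ENNReal.ofReal δ * ENNReal.ofReal (baseFreq L) *
      ((ebracket ξ ^ k * ebracket η ^ k * ebracket (ξ - η) +
        ebracket ξ ^ k * ebracket η ^ (k - 2) * ebracket (ξ - η) ^ 3 +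
        ebracket ξ ^ (k - 2) * ebracket η ^ k * ebracket (ξ - η) ^ 3) *
          (‖coeff v ξ‖ₑ * ‖coeff v η‖ₑ * speed u (ξ - η))) := by
    intro ξ η
    have h1 : ‖w ξ - w η‖ₑ ≤ ENNReal.ofReal δ *
        ENNReal.ofReal |bracket ξ ^ (2 * k) - bracket η ^ (2 * k)| := by
      rw [← ENNReal.ofReal_mul hδ, ← ofReal_norm]
      exact ENNReal.ofReal_le_ofReal (hdiff ξ η)
    calc _ ≤ (ENNReal.ofReal δ *
        ENNReal.ofReal |bracket ξ ^ (2 * k) - bracket η ^ (2 * k)|) *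
        (ENNReal.ofReal (baseFreq L) * (min (ebracket ξ) (ebracket η) *
        (‖coeff v ξ‖ₑ * ‖coeff v η‖ₑ * speed u (ξ - η)))) := mul_le_mul' h1 (hbound ξ η)
      _ = ENNReal.ofReal δ * ENNReal.ofReal (baseFreq L) *
        (ENNReal.ofReal |bracket ξ ^ (2 * k) - bracket η ^ (2 * k)| *
          min (ebracket ξ) (ebracket η)) *
        (‖coeff v ξ‖ₑ * ‖coeff v η‖ₑ * speed u (ξ - η)) := by ring
      _ ≤ _ := mul_le_mul_left (mul_le_mul_right (ebracket_commutator hk ξ η) _) _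
      _ = _ := by ring
  calc _ ≤ _ := ENNReal.tsum_le_tsum fun ξ => ENNReal.tsum_le_tsum fun η => hpt ξ η
    -- The constant `36` is the `12` of the commutator times the three trilinear terms.
    _ ≤ 12 * ENNReal.ofReal δ * ENNReal.ofReal (baseFreq L) *
        (3 * (embConst * sobolevNorm k v ^ 2 * velNorm u)) := by
        simp only [ENNReal.tsum_mul_left]
        gcongr
        exact tsum_trilinear_le k (by omega) v u
    _ = _ := by ring

/-! ### The streamfunction -/

theorem sobolevNorm_smul_le (k : ℕ) (c : ℝ) (v : L2 L) :
    sobolevNorm k (c • v) ≤ ‖c‖ₑ * sobolevNorm k v := by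
  rw [sobolevNorm_eq, sobolevNorm_eq, ← l2Norm_const_mul]
  refine l2Norm_mono fun ξ => ?_
  rw [coeff_smul, enorm_mul, ← ofReal_norm (c : ℂ), Complex.norm_real, ofReal_norm, mul_left_comm]

theorem MemSobolev.smul {k : ℕ} {v : L2 L} (hv : MemSobolev k v) (c : ℝ) :
    MemSobolev k (c • v) :=
  (sobolevNorm_smul_le k c v).trans_lt (ENNReal.mul_lt_top enorm_lt_top hv)

theorem MemSobolev.laplacian {k : ℕ} {v : L2 L} (hv : MemSobolev (k + 2) v) :
    MemSobolev k (laplacian v) :=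
  ((MemSobolev.weakDeriv (k := k + 1) hv 0).weakDeriv 0).add
    ((MemSobolev.weakDeriv (k := k + 1) hv 1).weakDeriv 1)

/-- The symbol `(2 π / L)² |ξ|²` of `-Δ`. -/
def laplaceSymbol (L : ℝ) (ξ : Freq) : ℝ := baseFreq L ^ 2 * ∑ j, (ξ j : ℝ) ^ 2

theorem laplaceSymbol_nonneg (L : ℝ) (ξ : Freq) : 0 ≤ laplaceSymbol L ξ := by
  unfold laplaceSymbol
  positivity

theorem coeff_laplacian {v : L2 L} (hv : MemSobolev 2 v) (ξ : Freq) :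
    coeff (laplacian v) ξ = -(laplaceSymbol L ξ * coeff v ξ) := by
  have hg : ∀ j, MemSobolev 1 (grad v j) := fun j => MemSobolev.weakDeriv (k := 1) hv j
  rw [laplacian, coeff_divergence hg]
  simp only [grad, coeff_weakDeriv (hv.mono one_le_two), derivSymbol_eq, laplaceSymbol,
    Fin.sum_univ_two]
  push_cast
  linear_combination (baseFreq L ^ 2 * ((ξ 0 : ℂ) ^ 2 + (ξ 1 : ℂ) ^ 2) * coeff v ξ) * Complex.I_sq

/-- The symbol of `(1 - Δ)(1 - α Δ)`. -/
def streamSymbol (L α : ℝ) (ξ : Freq) : ℝ :=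
  (1 + laplaceSymbol L ξ) * (1 + α * laplaceSymbol L ξ)

theorem IsStreamfunction.coeff_sub {α : ℝ} {f ω ψ : L2 L} (h : IsStreamfunction α f ω ψ)
    (ξ : Freq) : coeff (ω - f) ξ = -(streamSymbol L α ξ * coeff ψ ξ) := by
  obtain ⟨hψ, rfl⟩ := h
  have h2 : MemSobolev 2 (ψ - α • laplacian ψ) :=
    (hψ.mono (by omega)).sub (MemSobolev.smul (MemSobolev.laplacian (k := 2) hψ) α)
  rw [add_sub_cancel_right, TQG.coeff_sub, coeff_laplacian h2, TQG.coeff_sub, coeff_smul,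
    coeff_laplacian (hψ.mono (by omega)), streamSymbol]
  push_cast
  ring

/-- The constant of elliptic regularity for the streamfunction. -/
def streamConst (L α : ℝ) : ℝ := (1 + (baseFreq L ^ 2)⁻¹) * (1 + (α * baseFreq L ^ 2)⁻¹)

theorem bracket_pow_four_le {α : ℝ} (hα : 0 < α) (ξ : Freq) :
    bracket ξ ^ 4 ≤ streamConst L α * streamSymbol L α ξ := by
  have hb := baseFreq_pos (L := L)
  have h0 : 0 ≤ ∑ j, (ξ j : ℝ) ^ 2 := by positivity
  rw [show bracket ξ ^ 4 = (bracket ξ ^ 2) * (bracket ξ ^ 2) by ring, bracket_sq]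
  -- One inequality serves both second-order factors, with `c` the coefficient of `|ξ|²` in each.
  have h1 : ∀ c : ℝ, 0 < c → 1 + ∑ j, (ξ j : ℝ) ^ 2 ≤
      (1 + c⁻¹) * (1 + c * ∑ j, (ξ j : ℝ) ^ 2) := by
    intro c hc
    have e : (1 + c⁻¹) * (1 + c * ∑ j, (ξ j : ℝ) ^ 2) =
        1 + ∑ j, (ξ j : ℝ) ^ 2 + c⁻¹ + c * ∑ j, (ξ j : ℝ) ^ 2 := by
      field_simp
      ring
    have : 0 ≤ c⁻¹ + c * ∑ j, (ξ j : ℝ) ^ 2 := by positivity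
    rw [e]
    linarith
  have h2 := h1 (baseFreq L ^ 2) (by positivity)
  have h3 := h1 (α * baseFreq L ^ 2) (by positivity)
  calc _ ≤ _ := mul_le_mul h2 h3 (by positivity) (by positivity)
    _ = _ := by
      rw [streamConst, streamSymbol, laplaceSymbol]
      ring

/-- Elliptic regularity, stated for the relation between coefficients so that it also covers
differences of streamfunctions, where `f` cancels. -/
theorem sobolevNorm_four_le {α : ℝ} (hα : 0 < α) {g ψ : L2 L}
    (h : ∀ ξ, coeff g ξ = -(streamSymbol L α ξ * coeff ψ ξ)) :
    sobolevNorm 4 ψ ≤ ENNReal.ofReal (streamConst L α) * sobolevNorm 0 g := by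
  rw [sobolevNorm_eq, sobolevNorm_eq, ← l2Norm_const_mul]
  refine l2Norm_mono fun ξ => ?_
  have hs : 0 ≤ streamSymbol L α ξ := by
    have := laplaceSymbol_nonneg L ξ
    unfold streamSymbol
    positivity
  have hb := baseFreq_pos (L := L)
  have hc : 0 ≤ streamConst L α := by
    unfold streamConst
    positivity
  rw [h, enorm_neg, enorm_mul, pow_zero, one_mul, ← mul_assoc, ← ofReal_norm (streamSymbol L α ξ : ℂ),
    Complex.norm_real, Real.norm_of_nonneg hs, ← ENNReal.ofReal_mul hc, ebracket,
    ← ENNReal.ofReal_pow (bracket_pos ξ).le]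
  gcongr
  exact bracket_pow_four_le hα ξ

theorem velNorm_perpGrad_le {ψ : L2 L} (hψ : MemSobolev 4 ψ) :
    velNorm (perpGrad ψ) ≤ 2 * ENNReal.ofReal (baseFreq L) * sobolevNorm 4 ψ := by
  have h : ∀ j, sobolevNorm 3 (weakDeriv j ψ) ≤ ENNReal.ofReal (baseFreq L) * sobolevNorm 4 ψ :=
    fun j => sobolevNorm_weakDeriv_le (hψ.mono (by omega)) j
  rw [velNorm, Fin.sum_univ_two, mul_assoc, two_mul]
  simp only [perpGrad, Matrix.cons_val_zero, Matrix.cons_val_one, sobolevNorm_neg]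
  exact add_le_add (h 1) (h 0)

theorem memSobolev_perpGrad {ψ : L2 L} (hψ : MemSobolev 4 ψ) (j : Fin 2) :
    MemSobolev 3 (perpGrad ψ j) := by
  refine (Finset.single_le_sum (f := fun j => sobolevNorm 3 (perpGrad ψ j))
    (fun _ _ => zero_le) (Finset.mem_univ j)).trans_lt ((velNorm_perpGrad_le hψ).trans_lt ?_)
  exact ENNReal.mul_lt_top (ENNReal.mul_lt_top (by simp) ENNReal.ofReal_lt_top) hψ

theorem perpGrad_sub {ψ ψ' : L2 L} (hψ : MemSobolev 4 ψ) (hψ' : MemSobolev 4 ψ') :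
    perpGrad (ψ - ψ') = perpGrad ψ - perpGrad ψ' := by
  have h := weakDeriv_sub (hψ.mono (show 1 ≤ 4 by omega)) (hψ'.mono (show 1 ≤ 4 by omega))
  ext1 j
  fin_cases j
  · simp [perpGrad, h]
    abel
  · simp [perpGrad, h]

theorem divFree_perpGrad {ψ : L2 L} (hψ : MemSobolev 4 ψ) : DivFree (perpGrad ψ) := by
  intro ξ
  have h1 : MemSobolev 1 ψ := hψ.mono (by omega)
  simp only [Fin.sum_univ_two, perpGrad, Matrix.cons_val_zero, Matrix.cons_val_one, coeff_neg,
    coeff_weakDeriv h1, derivSymbol_eq]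
  ring

theorem divFree_of_divergence_eq_zero {u : Fin 2 → L2 L} (hu : ∀ j, MemSobolev 1 (u j))
    (h : divergence u = 0) : DivFree u := by
  intro ξ
  have h1 := coeff_divergence hu ξ
  rw [h, coeff_zero] at h1
  simp only [derivSymbol_eq, mul_assoc, ← Finset.mul_sum] at h1
  have hb : (baseFreq L : ℂ) ≠ 0 := by exact_mod_cast baseFreq_pos.ne'
  simpa [Complex.I_ne_zero, hb] using h1.symm

/-- The constant in the bound of the velocity by the potential vorticity. -/
def velConst (L α : ℝ) : ℝ≥0∞ :=
  2 * ENNReal.ofReal (baseFreq L) * ENNReal.ofReal (streamConst L α)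

theorem velConst_ne_top (L α : ℝ) : velConst L α ≠ ∞ :=
  ENNReal.mul_ne_top (ENNReal.mul_ne_top (by simp) ENNReal.ofReal_ne_top) ENNReal.ofReal_ne_top

theorem IsStreamfunction.velNorm_le {α : ℝ} (hα : 0 < α) {f ω ψ : L2 L}
    (h : IsStreamfunction α f ω ψ) :
    velNorm (perpGrad ψ) ≤ velConst L α * sobolevNorm 0 (ω - f) := by
  refine (velNorm_perpGrad_le h.1).trans ?_
  rw [velConst, mul_assoc _ (ENNReal.ofReal (streamConst L α))]
  gcongr
  exact sobolevNorm_four_le hα h.coeff_sub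

/-- Continuity in time of the velocity is inherited from that of `ω`; none is assumed for `ψ`. -/
theorem IsStreamfunction.velNorm_sub_le {α : ℝ} (hα : 0 < α) {f ω ω' ψ ψ' : L2 L}
    (h : IsStreamfunction α f ω ψ) (h' : IsStreamfunction α f ω' ψ') :
    velNorm (perpGrad ψ - perpGrad ψ') ≤ velConst L α * sobolevNorm 0 (ω - ω') := by
  rw [← perpGrad_sub h.1 h'.1]
  refine (velNorm_perpGrad_le (h.1.sub h'.1)).trans ?_
  rw [velConst, mul_assoc _ (ENNReal.ofReal (streamConst L α))]
  gcongr
  refine sobolevNorm_four_le hα fun ξ => ?_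
  have h1 := h.coeff_sub ξ
  have h2 := h'.coeff_sub ξ
  rw [TQG.coeff_sub] at h1 h2 ⊢
  rw [TQG.coeff_sub]
  linear_combination h1 - h2

/-! ### Continuity in time of the transport terms -/

theorem velNorm_add_le (u u' : Fin 2 → L2 L) : velNorm (u + u') ≤ velNorm u + velNorm u' := by
  rw [velNorm, velNorm, velNorm, ← Finset.sum_add_distrib]
  exact Finset.sum_le_sum fun j _ => sobolevNorm_add_le _ _ _

theorem velNorm_lt_top {u : Fin 2 → L2 L} (hu : ∀ j, MemSobolev 3 (u j)) : velNorm u < ∞ :=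
  ENNReal.sum_lt_top.mpr fun j _ => hu j

theorem ContinuousInSobolev.mono {k l : ℕ} (h : k ≤ l) {T : ℝ} {v : ℝ → L2 L}
    (hv : ContinuousInSobolev l T v) : ContinuousInSobolev k T v :=
  ⟨fun t ht => (hv.1 t ht).mono h, fun t ht => tendsto_of_tendsto_of_tendsto_of_le_of_le
    tendsto_const_nhds (hv.2 t ht) (fun _ => zero_le) fun _ => sobolevNorm_mono h _⟩

theorem ContinuousInSobolev.sub {k : ℕ} {T : ℝ} {v w : ℝ → L2 L}
    (hv : ContinuousInSobolev k T v) (hw : ContinuousInSobolev k T w) :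
    ContinuousInSobolev k T fun t => v t - w t := by
  refine ⟨fun t ht => (hv.1 t ht).sub (hw.1 t ht), fun t ht => ?_⟩
  have h := (hv.2 t ht).add (hw.2 t ht)
  rw [add_zero] at h
  refine tendsto_of_tendsto_of_tendsto_of_le_of_le tendsto_const_nhds h (fun _ => zero_le)
    fun s => ?_
  rw [sub_sub_sub_comm]
  exact sobolevNorm_sub_le _ _ _

/-- Makes the integrands of the system continuous in `L²`, so that the Bochner integrals are genuine
and can be differentiated. -/
theorem continuousOn_transport {T : ℝ} {v : ℝ → L2 L} (hv : ContinuousInSobolev 2 T v)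
    {u : ℝ → Fin 2 → L2 L} (hu : ∀ t ∈ Icc 0 T, ∀ j, MemSobolev 3 (u t j))
    (hu' : ∀ t ∈ Icc 0 T, Tendsto (fun s => velNorm (u s - u t)) (𝓝[Icc 0 T] t) (𝓝 0)) :
    ContinuousOn (fun t => divergence (mulVec (v t) (u t))) (Icc 0 T) := by
  intro t ht
  rw [ContinuousWithinAt, tendsto_iff_edist_tendsto_0]
  set C := ENNReal.ofReal (baseFreq L) * (2 * embConst) with hC
  have hCtop : C ≠ ∞ := ENNReal.mul_ne_top ENNReal.ofReal_ne_top
    (ENNReal.mul_ne_top (by simp) embConst_ne_top)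
  have hVtop := (velNorm_lt_top (hu t ht)).ne
  have hvtop : sobolevNorm 1 (v t) ≠ ∞ := ((hv.1 t ht).mono one_le_two).ne
  have h1 := (hv.mono one_le_two).2 t ht
  have h2 := hu' t ht
  have h3 : Tendsto (fun s => C * (sobolevNorm 1 (v s - v t) * (velNorm (u s - u t) + velNorm (u t))
      + sobolevNorm 1 (v t) * velNorm (u s - u t))) (𝓝[Icc 0 T] t)
      (𝓝 (C * (0 * (0 + velNorm (u t)) + sobolevNorm 1 (v t) * 0))) := by
    refine ENNReal.Tendsto.const_mul (Tendsto.add ?_ ?_) (Or.inr hCtop)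
    · exact ENNReal.Tendsto.mul h1 (Or.inr (by simpa using hVtop)) (h2.add tendsto_const_nhds)
        (Or.inr ENNReal.zero_ne_top)
    · exact ENNReal.Tendsto.const_mul h2 (Or.inr hvtop)
  simp only [zero_mul, mul_zero, add_zero] at h3
  refine tendsto_of_tendsto_of_tendsto_of_le_of_le' tendsto_const_nhds h3
    (Eventually.of_forall fun _ => zero_le) ?_
  filter_upwards [self_mem_nhdsWithin] with s hs
  have hsub : ∀ j, MemSobolev 3 ((u s - u t) j) := fun j => (hu s hs j).sub (hu t ht j)
  rw [edist_eq_enorm_sub, divergence_mulVec_sub (hv.1 s hs) (hv.1 t ht) (hu s hs) (hu t ht)]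
  have h4 : velNorm (u s) ≤ velNorm (u s - u t) + velNorm (u t) := by
    simpa using velNorm_add_le (u s - u t) (u t)
  calc _ ≤ _ := enorm_add_le _ _
    _ ≤ ENNReal.ofReal (baseFreq L) * (2 * embConst * sobolevNorm 1 (v s - v t) * velNorm (u s)) +
        ENNReal.ofReal (baseFreq L) *
          (2 * embConst * sobolevNorm 1 (v t) * velNorm (u s - u t)) :=
      add_le_add (enorm_divergence_mulVec_le ((hv.1 s hs).sub (hv.1 t ht)) (hu s hs))
        (enorm_divergence_mulVec_le (hv.1 t ht) hsub)
    _ = C * (sobolevNorm 1 (v s - v t) * velNorm (u s) +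
        sobolevNorm 1 (v t) * velNorm (u s - u t)) := by
      rw [hC]
      ring
    _ ≤ _ := by gcongr

/-! ### Primitives and Grönwall's inequality -/

theorem hasDerivAt_primitive {E : Type*} [NormedAddCommGroup E] [NormedSpace ℝ E]
    [CompleteSpace E] {T : ℝ} {g : ℝ → E} (hg : ContinuousOn g (Icc 0 T)) {t : ℝ}
    (ht : t ∈ Ioo 0 T) : HasDerivAt (fun t => ∫ s in (0 : ℝ)..t, g s) (g t) t := by
  refine intervalIntegral.integral_hasDerivAt_right ?_ ?_ ?_
  · refine (hg.mono ?_).intervalIntegrable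
    rw [uIcc_of_le ht.1.le]
    exact Icc_subset_Icc_right ht.2.le
  · exact (hg.mono Ioo_subset_Icc_self).stronglyMeasurableAtFilter isOpen_Ioo t ht
  · exact hg.continuousAt (Icc_mem_nhds ht.1 ht.2)

theorem continuousOn_primitive {E : Type*} [NormedAddCommGroup E] [NormedSpace ℝ E]
    {T : ℝ} (hT : 0 ≤ T) {g : ℝ → E} (hg : ContinuousOn g (Icc 0 T)) :
    ContinuousOn (fun t => ∫ s in (0 : ℝ)..t, g s) (Icc 0 T) := by
  rw [← uIcc_of_le hT] at hg ⊢
  exact intervalIntegral.continuousOn_primitive_interval' hg.intervalIntegrable left_mem_uIcc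

theorem intervalIntegrable_of_continuousOn {E : Type*} [NormedAddCommGroup E]
    {T : ℝ} {g : ℝ → E} (hg : ContinuousOn g (Icc 0 T)) {t : ℝ}
    (ht : t ∈ Icc 0 T) : IntervalIntegrable g volume 0 t := by
  refine (hg.mono ?_).intervalIntegrable
  rw [uIcc_of_le ht.1]
  exact Icc_subset_Icc_right ht.2

/-- **Grönwall's inequality** in integral form. -/
theorem gronwall_integral {T A : ℝ} {y h : ℝ → ℝ} (hy : ContinuousOn y (Icc 0 T))
    (hh : ContinuousOn h (Icc 0 T)) (h0 : ∀ t ∈ Icc 0 T, 0 ≤ h t)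
    (hle : ∀ t ∈ Icc 0 T, y t ≤ A + ∫ s in (0 : ℝ)..t, h s * y s) {t : ℝ} (ht : t ∈ Icc 0 T) :
    y t ≤ A * Real.exp (∫ s in (0 : ℝ)..t, h s) := by
  have hT : 0 ≤ T := ht.1.trans ht.2
  have hhy : ContinuousOn (fun s => h s * y s) (Icc 0 T) := hh.mul hy
  set P : ℝ → ℝ := fun t => ∫ s in (0 : ℝ)..t, h s * y s with hP
  set Q : ℝ → ℝ := fun t => ∫ s in (0 : ℝ)..t, h s with hQ
  have hcont : ContinuousOn (fun t => (A + P t) * Real.exp (-Q t)) (Icc 0 T) :=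
    (continuousOn_const.add (continuousOn_primitive hT hhy)).mul
      (continuousOn_primitive hT hh).neg.rexp
  have hderiv : ∀ t ∈ Ioo 0 T, HasDerivAt (fun t => (A + P t) * Real.exp (-Q t))
      (h t * y t * Real.exp (-Q t) + (A + P t) * (Real.exp (-Q t) * -h t)) t := fun t ht =>
    ((hasDerivAt_primitive hhy ht).const_add A).mul (hasDerivAt_primitive hh ht).neg.exp
  -- Integrating factor: the majorant `A + P` has derivative `h y ≤ h (A + P)`.
  have hanti : AntitoneOn (fun t => (A + P t) * Real.exp (-Q t)) (Icc 0 T) := by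
    refine antitoneOn_of_deriv_nonpos (convex_Icc 0 T) hcont ?_ ?_
    · rw [interior_Icc]
      exact fun t ht => (hderiv t ht).differentiableAt.differentiableWithinAt
    · rw [interior_Icc]
      intro t ht
      have ht' := Ioo_subset_Icc_self ht
      rw [(hderiv t ht).deriv]
      have h1 : 0 ≤ h t * (A + P t - y t) * Real.exp (-Q t) :=
        mul_nonneg (mul_nonneg (h0 t ht') (sub_nonneg.mpr (hle t ht'))) (Real.exp_pos _).le
      linarith
  have h1 := hanti (left_mem_Icc.mpr hT) ht ht.1
  simp only [hP, hQ, intervalIntegral.integral_same, add_zero, neg_zero, Real.exp_zero,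
    mul_one] at h1
  calc y t ≤ A + P t := hle t ht
    _ = (A + P t) * Real.exp (-Q t) * Real.exp (Q t) := by
      rw [mul_assoc, ← Real.exp_add, neg_add_cancel, Real.exp_zero, mul_one]
    _ ≤ _ := mul_le_mul_of_nonneg_right h1 (Real.exp_pos _).le

/-! ### Energy estimates -/

/-- With finitely many modes the energy identity is the fundamental theorem of calculus for each
coefficient, and requires nothing beyond continuity of `G` in `L²`. -/
theorem sum_weight_energy_eq {T : ℝ} {v G : ℝ → L2 L} {v₀ : L2 L}
    (hG : ContinuousOn G (Icc 0 T))
    (hv : ∀ t ∈ Icc 0 T, v t = v₀ - ∫ s in (0 : ℝ)..t, G s) (S : Finset Freq) (w : Freq → ℝ)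
    {t : ℝ} (ht : t ∈ Icc 0 T) :
    ∑ ξ ∈ S, w ξ * ‖coeff (v t) ξ‖ ^ 2 = ∑ ξ ∈ S, w ξ * ‖coeff v₀ ξ‖ ^ 2 +
      ∫ s in (0 : ℝ)..t, -(2 * ∑ ξ ∈ S, w ξ * (conj (coeff (v s) ξ) * coeff (G s) ξ).re) := by
  have hT : 0 ≤ T := ht.1.trans ht.2
  have hGc : ∀ ξ, ContinuousOn (fun s => coeff (G s) ξ) (Icc 0 T) := by
    intro ξ
    simp only [← coeffCLM_apply]
    exact (coeffCLM L ξ).continuous.comp_continuousOn hG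
  set x : Freq → ℝ → ℂ := fun ξ t => coeff v₀ ξ - ∫ s in (0 : ℝ)..t, coeff (G s) ξ with hx
  have hxv : ∀ ξ, ∀ t ∈ Icc 0 T, coeff (v t) ξ = x ξ t := by
    intro ξ t ht
    rw [hv t ht, coeff_sub, hx]
    simp only [← coeffCLM_apply]
    rw [← (coeffCLM L ξ).intervalIntegral_comp_comm (intervalIntegrable_of_continuousOn hG ht)]
  have hxc : ∀ ξ, ContinuousOn (x ξ) (Icc 0 T) := fun ξ =>
    continuousOn_const.sub (continuousOn_primitive hT (hGc ξ))
  have hsub : Icc 0 t ⊆ Icc 0 T := Icc_subset_Icc_right ht.2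
  have hd : ∀ s ∈ Ioo 0 t, HasDerivAt (fun s => ∑ ξ ∈ S, w ξ * ‖x ξ s‖ ^ 2)
      (-(2 * ∑ ξ ∈ S, w ξ * (conj (x ξ s) * coeff (G s) ξ).re)) s := by
    intro s hs
    have h1 : ∀ ξ ∈ S, HasDerivAt (fun s => w ξ * ‖x ξ s‖ ^ 2)
        (w ξ * (2 * inner ℝ (x ξ s) (-coeff (G s) ξ))) s := fun ξ _ =>
      (((hasDerivAt_primitive (hGc ξ) ⟨hs.1, hs.2.trans_le ht.2⟩).const_sub
        (coeff v₀ ξ)).norm_sq).const_mul (w ξ)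
    have e : -(2 * ∑ ξ ∈ S, w ξ * (conj (x ξ s) * coeff (G s) ξ).re) =
        ∑ ξ ∈ S, w ξ * (2 * inner ℝ (x ξ s) (-coeff (G s) ξ)) := by
      rw [Finset.mul_sum, ← Finset.sum_neg_distrib]
      refine Finset.sum_congr rfl fun ξ _ => ?_
      rw [inner_neg_right, Complex.inner]
      ring_nf
    rw [e]
    exact HasDerivAt.fun_sum h1
  have hint : IntervalIntegrable
      (fun s => -(2 * ∑ ξ ∈ S, w ξ * (conj (x ξ s) * coeff (G s) ξ).re)) volume 0 t := by
    refine intervalIntegrable_of_continuousOn (T := T) ?_ ht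
    refine (continuousOn_const.mul (continuousOn_finsetSum S fun ξ _ =>
      continuousOn_const.mul (Complex.continuous_re.comp_continuousOn
        ((Complex.continuous_conj.comp_continuousOn (hxc ξ)).mul (hGc ξ))))).neg
  have hcont : ContinuousOn (fun s => ∑ ξ ∈ S, w ξ * ‖x ξ s‖ ^ 2) (Icc 0 T) :=
    continuousOn_finsetSum S fun ξ _ => continuousOn_const.mul ((hxc ξ).norm.pow 2)
  have hftc := intervalIntegral.integral_eq_sub_of_hasDerivAt_of_le ht.1 (hcont.mono hsub) hd hint
  have hcongr : ∫ s in (0 : ℝ)..t,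
      -(2 * ∑ ξ ∈ S, w ξ * (conj (coeff (v s) ξ) * coeff (G s) ξ).re) =
      ∫ s in (0 : ℝ)..t, -(2 * ∑ ξ ∈ S, w ξ * (conj (x ξ s) * coeff (G s) ξ).re) := by
    refine intervalIntegral.integral_congr fun s hs => ?_
    rw [uIcc_of_le ht.1] at hs
    simp only [hxv _ s (hsub hs)]
  have hx0 : ∀ ξ, x ξ 0 = coeff v₀ ξ := fun ξ => by simp [hx]
  rw [hcongr, hftc]
  simp only [hx0, hxv _ t ht]
  ring

theorem hasSum_sobolevNorm_sq {k : ℕ} {v : L2 L} (hv : MemSobolev k v) :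
    HasSum (fun ξ => bracket ξ ^ (2 * k) * ‖coeff v ξ‖ ^ 2) ((sobolevNorm k v).toReal ^ 2) := by
  have h1 : sobolevNorm k v ^ 2 =
      ∑' ξ, ENNReal.ofReal (bracket ξ ^ (2 * k) * ‖coeff v ξ‖ ^ 2) := by
    rw [sobolevNorm_eq, l2Norm_sq]
    refine tsum_congr fun ξ => ?_
    rw [mul_pow, ebracket, ← ofReal_norm, ENNReal.ofReal_mul (by have := bracket_pos ξ; positivity),
      ENNReal.ofReal_pow (bracket_pos ξ).le, ENNReal.ofReal_pow (norm_nonneg _), ← pow_mul,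
      mul_comm k]
  have h2 : sobolevNorm k v ^ 2 ≠ ∞ := ENNReal.pow_ne_top hv.ne
  rw [← ENNReal.toReal_pow, h1]
  rw [h1] at h2
  have h3 := ENNReal.hasSum_toReal h2
  have h0 : ∀ ξ, 0 ≤ bracket ξ ^ (2 * k) * ‖coeff v ξ‖ ^ 2 := fun ξ => by
    have := bracket_pos ξ
    positivity
  rw [ENNReal.tsum_toReal_eq fun _ => ENNReal.ofReal_ne_top]
  simpa only [ENNReal.toReal_ofReal (h0 _)] using h3

/-- Passage from truncated weights to the full norm. The error `ε N * D` allows `D` to involve norms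
with no uniform control, since it disappears in the limit. -/
theorem sobolevNorm_sq_le_of_weights (k : ℕ) {T : ℝ} {v G : ℝ → L2 L} {v₀ : L2 L}
    (hmem : ∀ t ∈ Icc 0 T, MemSobolev k (v t)) (hmem₀ : MemSobolev k v₀)
    (hG : ContinuousOn G (Icc 0 T))
    (hv : ∀ t ∈ Icc 0 T, v t = v₀ - ∫ s in (0 : ℝ)..t, G s) (S : ℕ → Finset Freq)
    (W : ℕ → Freq → ℝ) (hWS : ∀ N, ∀ ξ ∉ S N, W N ξ = 0) (hW0 : ∀ N ξ, 0 ≤ W N ξ)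
    (hWle : ∀ N ξ, W N ξ ≤ bracket ξ ^ (2 * k))
    (hWlim : ∀ ξ, Tendsto (fun N => W N ξ) atTop (𝓝 (bracket ξ ^ (2 * k))))
    {R D : ℝ → ℝ} (hR : ContinuousOn R (Icc 0 T)) (hD : ContinuousOn D (Icc 0 T)) {ε : ℕ → ℝ}
    (hε : Tendsto ε atTop (𝓝 0))
    (hbound : ∀ N, ∀ s ∈ Icc 0 T,
      |2 * ∑ ξ ∈ S N, W N ξ * (conj (coeff (v s) ξ) * coeff (G s) ξ).re| ≤ R s + ε N * D s)
    {t : ℝ} (ht : t ∈ Icc 0 T) :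
    (sobolevNorm k (v t)).toReal ^ 2 ≤ (sobolevNorm k v₀).toReal ^ 2 + ∫ s in (0 : ℝ)..t, R s := by
  have hRi := intervalIntegrable_of_continuousOn hR ht
  have hDi := intervalIntegrable_of_continuousOn hD ht
  have hsum := hasSum_sobolevNorm_sq (hmem t ht)
  have hsum₀ := hasSum_sobolevNorm_sq hmem₀
  -- A finite set of modes is fixed before `N → ∞`, so pointwise convergence of the weights is
  -- enough.
  refine hasSum_le_of_sum_le hsum fun A => ?_
  have hN : ∀ N, ∑ ξ ∈ A, W N ξ * ‖coeff (v t) ξ‖ ^ 2 ≤ (sobolevNorm k v₀).toReal ^ 2 +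
      ((∫ s in (0 : ℝ)..t, R s) + ε N * ∫ s in (0 : ℝ)..t, D s) := by
    intro N
    have h1 : ∑ ξ ∈ A, W N ξ * ‖coeff (v t) ξ‖ ^ 2 ≤ ∑ ξ ∈ S N, W N ξ * ‖coeff (v t) ξ‖ ^ 2 := by
      classical
      rw [← Finset.sum_filter_of_ne (p := fun ξ => ξ ∈ S N)]
      · refine Finset.sum_le_sum_of_subset_of_nonneg (fun ξ hξ => (Finset.mem_filter.mp hξ).2)
          fun ξ _ _ => mul_nonneg (hW0 N ξ) (sq_nonneg _)
      · intro ξ _ hne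
        by_contra hξ
        exact hne (by rw [hWS N ξ hξ, zero_mul])
    have h2 : ∑ ξ ∈ S N, W N ξ * ‖coeff v₀ ξ‖ ^ 2 ≤ (sobolevNorm k v₀).toReal ^ 2 :=
      (Finset.sum_le_sum fun ξ _ => mul_le_mul_of_nonneg_right (hWle N ξ) (sq_nonneg _)).trans
        (sum_le_hasSum _ (fun ξ _ => by have := bracket_pos ξ; positivity) hsum₀)
    have hGc : ContinuousOn (fun s =>
        -(2 * ∑ ξ ∈ S N, W N ξ * (conj (coeff (v s) ξ) * coeff (G s) ξ).re)) (Icc 0 T) := by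
      have hvc : ContinuousOn v (Icc 0 T) :=
        (continuousOn_const.sub (continuousOn_primitive (ht.1.trans ht.2) hG)).congr hv
      simp only [← coeffCLM_apply]
      exact (continuousOn_const.mul (continuousOn_finsetSum _ fun ξ _ =>
        continuousOn_const.mul (Complex.continuous_re.comp_continuousOn
          ((Complex.continuous_conj.comp_continuousOn
            ((coeffCLM L ξ).continuous.comp_continuousOn hvc)).mul
              ((coeffCLM L ξ).continuous.comp_continuousOn hG))))).neg
    have h3 : ∫ s in (0 : ℝ)..t,
        -(2 * ∑ ξ ∈ S N, W N ξ * (conj (coeff (v s) ξ) * coeff (G s) ξ).re) ≤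
        ∫ s in (0 : ℝ)..t, (R s + ε N * D s) := by
      refine intervalIntegral.integral_mono_on ht.1 (intervalIntegrable_of_continuousOn hGc ht)
        (hRi.add (hDi.const_mul _)) fun s hs => ?_
      exact (neg_le_abs _).trans (hbound N s ⟨hs.1, hs.2.trans ht.2⟩)
    rw [intervalIntegral.integral_add hRi (hDi.const_mul _),
      intervalIntegral.integral_const_mul] at h3
    rw [sum_weight_energy_eq hG hv (S N) (W N) ht] at h1
    linarith
  have hl : Tendsto (fun N => ∑ ξ ∈ A, W N ξ * ‖coeff (v t) ξ‖ ^ 2) atTop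
      (𝓝 (∑ ξ ∈ A, bracket ξ ^ (2 * k) * ‖coeff (v t) ξ‖ ^ 2)) :=
    tendsto_finsetSum _ fun ξ _ => (hWlim ξ).mul_const _
  have hr : Tendsto (fun N => (sobolevNorm k v₀).toReal ^ 2 +
      ((∫ s in (0 : ℝ)..t, R s) + ε N * ∫ s in (0 : ℝ)..t, D s)) atTop
      (𝓝 ((sobolevNorm k v₀).toReal ^ 2 + ((∫ s in (0 : ℝ)..t, R s) +
        0 * ∫ s in (0 : ℝ)..t, D s))) :=
    tendsto_const_nhds.add (tendsto_const_nhds.add (hε.mul_const _))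
  rw [zero_mul, add_zero] at hr
  exact le_of_tendsto_of_tendsto' hl hr hN

/-! ### Weights of finite support -/

theorem finite_bracket_le (M : ℝ) : {ξ : Freq | bracket ξ ^ 4 ≤ M}.Finite := by
  have h := summable_bracket_inv.tendsto_cofinite_zero
  have h1 : ∀ᶠ ξ : Freq in cofinite, (bracket ξ ^ 4)⁻¹ < (|M| + 1)⁻¹ :=
    h.eventually (gt_mem_nhds (by positivity))
  refine (h1 : Set.Finite _).subset fun ξ hξ => ?_
  have hb : 0 < bracket ξ ^ 4 := by
    have := bracket_pos ξ
    positivity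
  simp only [mem_compl_iff, mem_ofPred_eq, not_lt] at hξ ⊢
  exact inv_anti₀ hb (hξ.trans ((le_abs_self M).trans (by linarith)))

/-- The frequencies with `⟨ξ⟩⁴ ≤ M`. -/
def freqBall (M : ℝ) : Finset Freq := (finite_bracket_le M).toFinset

theorem lt_of_notMem_freqBall {M : ℝ} {ξ : Freq} (h : ξ ∉ freqBall M) : M < bracket ξ ^ 4 := by
  simpa [freqBall] using h

/-- A piecewise linear cutoff: equal to the identity on `[0, N]`, supported in `[0, 2 N]`. -/
def hat (N x : ℝ) : ℝ := max 0 (min x (2 * N - x))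

theorem hat_nonneg (N x : ℝ) : 0 ≤ hat N x := le_max_left _ _

theorem hat_le (N : ℝ) {x : ℝ} (hx : 0 ≤ x) : hat N x ≤ x := max_le hx (min_le_left _ _)

theorem hat_eq_self {N x : ℝ} (h0 : 0 ≤ x) (hx : x ≤ N) : hat N x = x := by
  rw [hat, min_eq_left (by linarith), max_eq_right h0]

theorem hat_eq_zero {N x : ℝ} (hx : 2 * N ≤ x) : hat N x = 0 :=
  max_eq_left ((min_le_right _ _).trans (by linarith))

/-- A sharp truncation would create large increments; this cutoff is 1-Lipschitz, so the commutator
bound for `⟨ξ⟩^{2k}` survives uniformly in `N`. -/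
theorem abs_hat_sub_le (N x y : ℝ) : |hat N x - hat N y| ≤ |x - y| := by
  unfold hat
  refine (abs_max_sub_max_le_max _ _ _ _).trans (max_le (by simp) ?_)
  refine (abs_min_sub_min_le_max _ _ _ _).trans (max_le le_rfl ?_)
  rw [sub_sub_sub_cancel_left, abs_sub_comm]

/-! ### Energy estimates for a forced transport equation -/

theorem enorm_forced_transport_energy_le {k : ℕ} (hk : k = 2 ∨ k = 3) (l : ℕ) {v : L2 L}
    (hv : MemSobolev 2 v) (F : L2 L) {u : Fin 2 → L2 L} (hu : ∀ j, MemSobolev 3 (u j))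
    (hdiv : DivFree u) (S : Finset Freq) (w : Freq → ℝ) (hw : ∀ ξ ∉ S, w ξ = 0)
    (hw0 : ∀ ξ, 0 ≤ w ξ) (hwle : ∀ ξ, w ξ ≤ bracket ξ ^ (2 * l)) {δ : ℝ} (hδ : 0 ≤ δ)
    (hdiff : ∀ ξ η, |w ξ - w η| ≤ δ * |bracket ξ ^ (2 * k) - bracket η ^ (2 * k)|) :
    ‖2 * ∑ ξ ∈ S, w ξ * (conj (coeff v ξ) * coeff (divergence (mulVec v u) + F) ξ).re‖ₑ ≤
      36 * ENNReal.ofReal (baseFreq L) * embConst * ENNReal.ofReal δ *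
        sobolevNorm k v ^ 2 * velNorm u + 2 * sobolevNorm l v * sobolevNorm l F := by
  have e : 2 * ∑ ξ ∈ S, w ξ * (conj (coeff v ξ) * coeff (divergence (mulVec v u) + F) ξ).re =
      2 * ∑ ξ ∈ S, w ξ * (conj (coeff v ξ) * coeff (divergence (mulVec v u)) ξ).re +
      2 * ∑ ξ ∈ S, w ξ * (conj (coeff v ξ) * coeff F ξ).re := by
    simp only [coeff_add, mul_add, Complex.add_re, Finset.sum_add_distrib]
  rw [e]
  refine (enorm_add_le _ _).trans (add_le_add
    (enorm_transport_energy_le hk hv hu hdiv S w hw hδ hdiff) ?_)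
  rw [enorm_mul, mul_assoc 2]
  refine mul_le_mul' (le_of_eq ?_) (enorm_sum_weight_le l v F S w fun ξ => ?_)
  · rw [Real.enorm_eq_ofReal zero_le_two, ENNReal.ofReal_ofNat]
  rw [abs_of_nonneg (hw0 ξ)]
  exact hwle ξ

theorem abs_le_of_enorm_le {x r : ℝ} (hr : 0 ≤ r) (h : ‖x‖ₑ ≤ ENNReal.ofReal r) : |x| ≤ r := by
  rwa [← ofReal_norm, ENNReal.ofReal_le_ofReal_iff hr] at h

/-- The energy estimate in `W^{k,2}`. -/
theorem sobolev_energy_le {k : ℕ} (hk : k = 2 ∨ k = 3) {T : ℝ} {v F : ℝ → L2 L} {v₀ : L2 L}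
    {u : ℝ → Fin 2 → L2 L} (hmem : ∀ t ∈ Icc 0 T, MemSobolev k (v t)) (hmem₀ : MemSobolev k v₀)
    (hu : ∀ t ∈ Icc 0 T, ∀ j, MemSobolev 3 (u t j)) (hdiv : ∀ t ∈ Icc 0 T, DivFree (u t))
    (hG : ContinuousOn (fun s => divergence (mulVec (v s) (u s)) + F s) (Icc 0 T))
    (hv : ∀ t ∈ Icc 0 T, v t = v₀ - ∫ s in (0 : ℝ)..t, (divergence (mulVec (v s) (u s)) + F s))
    {R : ℝ → ℝ} (hR : ContinuousOn R (Icc 0 T)) (hR0 : ∀ s ∈ Icc 0 T, 0 ≤ R s)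
    (hbound : ∀ s ∈ Icc 0 T, 36 * ENNReal.ofReal (baseFreq L) * embConst *
      sobolevNorm k (v s) ^ 2 * velNorm (u s) + 2 * sobolevNorm k (v s) * sobolevNorm k (F s) ≤
      ENNReal.ofReal (R s)) {t : ℝ} (ht : t ∈ Icc 0 T) :
    (sobolevNorm k (v t)).toReal ^ 2 ≤ (sobolevNorm k v₀).toReal ^ 2 + ∫ s in (0 : ℝ)..t, R s := by
  have hpos : ∀ ξ, 0 ≤ bracket ξ ^ (2 * k) := fun ξ => by
    have := bracket_pos ξ
    positivity
  refine sobolevNorm_sq_le_of_weights k hmem hmem₀ hG hv (fun N => freqBall (2 * N))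
    (fun N ξ => hat N (bracket ξ ^ (2 * k))) (fun N ξ hξ => ?_) (fun N ξ => hat_nonneg _ _)
    (fun N ξ => hat_le _ (hpos ξ)) (fun ξ => ?_) hR (D := 0) continuousOn_const
    (ε := fun _ => 0) tendsto_const_nhds (fun N s hs => ?_) ht
  -- Here `2k ≥ 4`, so the ball defined by `⟨ξ⟩⁴` contains the support.
  · refine hat_eq_zero ((lt_of_notMem_freqBall hξ).le.trans ?_)
    exact pow_le_pow_right₀ (one_le_bracket ξ) (by omega)
  · refine tendsto_const_nhds.congr' ?_
    filter_upwards [eventually_ge_atTop ⌈bracket ξ ^ (2 * k)⌉₊] with N hN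
    exact (hat_eq_self (hpos ξ) (Nat.ceil_le.mp hN)).symm
  · refine abs_le_of_enorm_le (by simpa using hR0 s hs) ?_
    have h := enorm_forced_transport_energy_le hk k ((hmem s hs).mono (by omega)) (F s) (hu s hs)
      (hdiv s hs) (freqBall (2 * N)) (fun ξ => hat N (bracket ξ ^ (2 * k)))
      (fun ξ hξ => hat_eq_zero ((lt_of_notMem_freqBall hξ).le.trans
        (pow_le_pow_right₀ (one_le_bracket ξ) (by omega))))
      (fun ξ => hat_nonneg _ _) (fun ξ => hat_le _ (hpos ξ)) zero_le_one
      (fun ξ η => by rw [one_mul]; exact abs_hat_sub_le _ _ _)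
    rw [ENNReal.ofReal_one, mul_one] at h
    simpa using h.trans (hbound s hs)

/-- The energy estimate in `L²`. -/
theorem l2_energy_le {T : ℝ} {v F : ℝ → L2 L} {v₀ : L2 L}
    {u : ℝ → Fin 2 → L2 L} (hmem : ∀ t ∈ Icc 0 T, MemSobolev 2 (v t)) (hmem₀ : MemSobolev 2 v₀)
    (hu : ∀ t ∈ Icc 0 T, ∀ j, MemSobolev 3 (u t j)) (hdiv : ∀ t ∈ Icc 0 T, DivFree (u t))
    (hG : ContinuousOn (fun s => divergence (mulVec (v s) (u s)) + F s) (Icc 0 T))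
    (hv : ∀ t ∈ Icc 0 T, v t = v₀ - ∫ s in (0 : ℝ)..t, (divergence (mulVec (v s) (u s)) + F s))
    {R D : ℝ → ℝ} (hR : ContinuousOn R (Icc 0 T)) (hR0 : ∀ s ∈ Icc 0 T, 0 ≤ R s)
    (hD : ContinuousOn D (Icc 0 T)) (hD0 : ∀ s ∈ Icc 0 T, 0 ≤ D s)
    (hboundR : ∀ s ∈ Icc 0 T,
      2 * sobolevNorm 0 (v s) * sobolevNorm 0 (F s) ≤ ENNReal.ofReal (R s))
    (hboundD : ∀ s ∈ Icc 0 T, 36 * ENNReal.ofReal (baseFreq L) * embConst *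
      sobolevNorm 2 (v s) ^ 2 * velNorm (u s) ≤ ENNReal.ofReal (D s)) {t : ℝ} (ht : t ∈ Icc 0 T) :
    (sobolevNorm 0 (v t)).toReal ^ 2 ≤ (sobolevNorm 0 v₀).toReal ^ 2 + ∫ s in (0 : ℝ)..t, R s := by
  -- The weight `max 0 (1 - ε ⟨ξ⟩⁴)` has increments at most `ε` times those of `⟨ξ⟩⁴`. The `k = 2`
  -- commutator bound thus makes the transport term `O(ε)`, and only the forcing survives.
  set ε : ℕ → ℝ := fun N => 1 / ((N : ℝ) + 1) with hεdef
  have hε0 : ∀ N, 0 ≤ ε N := fun N => by positivity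
  have hε : Tendsto ε atTop (𝓝 0) := tendsto_one_div_add_atTop_nhds_zero_nat
  have hsupp : ∀ N : ℕ, ∀ ξ ∉ freqBall ((N : ℝ) + 1), max 0 (1 - ε N * bracket ξ ^ 4) = 0 := by
    intro N ξ hξ
    have h1 := lt_of_notMem_freqBall hξ
    have h2 : (0 : ℝ) < N + 1 := by positivity
    refine max_eq_left (sub_nonpos.mpr ?_)
    simp only [hεdef, one_div, inv_mul_eq_div]
    rw [one_le_div h2]
    exact h1.le
  have hle : ∀ N ξ, max 0 (1 - ε N * bracket ξ ^ 4) ≤ bracket ξ ^ (2 * 0) := by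
    intro N ξ
    have := bracket_pos ξ
    have := hε0 N
    refine max_le (by positivity) ?_
    rw [mul_zero, pow_zero, sub_le_self_iff]
    positivity
  refine sobolevNorm_sq_le_of_weights 0 (fun t ht => (hmem t ht).mono (by omega))
    (hmem₀.mono (by omega)) hG hv (fun N => freqBall ((N : ℝ) + 1))
    (fun N ξ => max 0 (1 - ε N * bracket ξ ^ 4)) hsupp (fun N ξ => le_max_left _ _) hle
    (fun ξ => ?_) hR hD hε (fun N s hs => ?_) ht
  · have h1 : Tendsto (fun N => max 0 (1 - ε N * bracket ξ ^ 4)) atTop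
        (𝓝 (max 0 (1 - 0 * bracket ξ ^ 4))) :=
      tendsto_const_nhds.max (tendsto_const_nhds.sub (hε.mul_const _))
    simpa using h1
  · refine abs_le_of_enorm_le (add_nonneg (hR0 s hs) (mul_nonneg (hε0 N) (hD0 s hs))) ?_
    have h := enorm_forced_transport_energy_le (Or.inl rfl) 0 (hmem s hs) (F s) (hu s hs)
      (hdiv s hs) (freqBall ((N : ℝ) + 1)) (fun ξ => max 0 (1 - ε N * bracket ξ ^ 4)) (hsupp N)
      (fun ξ => le_max_left _ _) (hle N) (hε0 N) (fun ξ η => by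
        refine (abs_max_sub_max_le_max _ _ _ _).trans (max_le ?_ ?_)
        · rw [sub_self, abs_zero]
          exact mul_nonneg (hε0 N) (abs_nonneg _)
        · rw [sub_sub_sub_cancel_left, ← mul_sub, abs_mul, abs_of_nonneg (hε0 N), abs_sub_comm])
    refine h.trans ?_
    rw [ENNReal.ofReal_add (hR0 s hs) (mul_nonneg (hε0 N) (hD0 s hs)),
      ENNReal.ofReal_mul (hε0 N), add_comm]
    refine add_le_add (hboundR s hs) ?_
    calc _ = ENNReal.ofReal (ε N) * (36 * ENNReal.ofReal (baseFreq L) * embConst *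
          sobolevNorm 2 (v s) ^ 2 * velNorm (u s)) := by ring
      _ ≤ _ := mul_le_mul_right (hboundD s hs) _

/-! ### Continuity in time of norms -/

theorem continuousOn_toReal_of_le_add {k : ℕ} {T : ℝ} {v : ℝ → L2 L}
    (hv : ContinuousInSobolev k T v) (N : L2 L → ℝ≥0∞)
    (hN : ∀ v w, N v ≤ N w + sobolevNorm k (v - w)) (hfin : ∀ t ∈ Icc 0 T, N (v t) ≠ ∞) :
    ContinuousOn (fun t => (N (v t)).toReal) (Icc 0 T) := by
  intro t ht
  refine (ENNReal.tendsto_toReal (hfin t ht)).comp ?_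
  have h := hv.2 t ht
  have h1 : Tendsto (fun s => N (v t) - sobolevNorm k (v s - v t)) (𝓝[Icc 0 T] t)
      (𝓝 (N (v t) - 0)) := ENNReal.Tendsto.sub tendsto_const_nhds h (Or.inl (hfin t ht))
  have h2 : Tendsto (fun s => N (v t) + sobolevNorm k (v s - v t)) (𝓝[Icc 0 T] t)
      (𝓝 (N (v t) + 0)) := tendsto_const_nhds.add h
  rw [tsub_zero] at h1
  rw [add_zero] at h2
  refine tendsto_of_tendsto_of_tendsto_of_le_of_le h1 h2 (fun s => ?_) fun s => hN _ _
  rw [tsub_le_iff_right, ← sobolevNorm_neg, neg_sub]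
  exact hN _ _

theorem sobolevNorm_le_add_sub (k : ℕ) (v w : L2 L) :
    sobolevNorm k v ≤ sobolevNorm k w + sobolevNorm k (v - w) := by
  simpa using sobolevNorm_add_le k w (v - w)

theorem ContinuousInSobolev.continuousOn_norm {k : ℕ} {T : ℝ} {v : ℝ → L2 L}
    (hv : ContinuousInSobolev k T v) :
    ContinuousOn (fun t => (sobolevNorm k (v t)).toReal) (Icc 0 T) :=
  continuousOn_toReal_of_le_add hv _ (sobolevNorm_le_add_sub k) fun t ht => (hv.1 t ht).ne

theorem gradNorm_le_sobolevNorm (v : L2 L) : gradNorm v ≤ sobolevNorm 1 v := by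
  rw [gradNorm, sobolevNorm_eq]
  refine l2Norm_mono fun ξ => ?_
  rw [pow_one]
  gcongr
  exact absFreq_le_ebracket ξ

theorem gradNorm_le_add_sub (v w : L2 L) :
    gradNorm v ≤ gradNorm w + sobolevNorm 1 (v - w) := by
  refine le_trans ?_ (add_le_add_right (gradNorm_le_sobolevNorm (v - w)) _)
  refine le_trans (l2Norm_mono fun ξ => ?_) (l2Norm_add_le _ _)
  rw [← mul_add]
  gcongr
  rw [coeff_sub]
  refine le_trans (le_of_eq ?_) (enorm_add_le _ _)
  rw [add_sub_cancel]

theorem ContinuousInSobolev.continuousOn_gradNorm {T : ℝ} {v : ℝ → L2 L}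
    (hv : ContinuousInSobolev 1 T v) :
    ContinuousOn (fun t => (gradNorm (v t)).toReal) (Icc 0 T) :=
  continuousOn_toReal_of_le_add hv _ gradNorm_le_add_sub fun t ht =>
    ((gradNorm_le_sobolevNorm _).trans_lt (hv.1 t ht)).ne

/-- The criterion's norm dominates the plain `L²` norm of the gradient, which is all that the
argument consumes. -/
theorem baseFreq_mul_gradNorm_le {v : L2 L} (hv : MemSobolev 1 v) :
    ENNReal.ofReal (baseFreq L) * gradNorm v ≤ vectorSobolevNorm 1 (grad v) := by
  apply le_of_sq_le_sq
  have h1 : vectorSobolevNorm 1 (grad v) ^ 2 = ∑ j, sobolevNorm 1 (grad v j) ^ 2 := by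
    rw [vectorSobolevNorm, ← ENNReal.rpow_natCast, ← ENNReal.rpow_mul]
    norm_num
  rw [h1, gradNorm, ← l2Norm_const_mul, l2Norm_sq]
  simp only [sobolevNorm_eq, l2Norm_sq, grad, coeff_weakDeriv hv]
  rw [← Summable.tsum_finsetSum fun _ _ => ENNReal.summable]
  refine ENNReal.tsum_le_tsum fun ξ => ?_
  have h2 : ∀ j, (ENNReal.ofReal (baseFreq L) * ENNReal.ofReal |(ξ j : ℝ)|) * ‖coeff v ξ‖ₑ ≤
      ebracket ξ ^ 1 * ‖derivSymbol L j ξ * coeff v ξ‖ₑ := by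
    intro j
    rw [enorm_mul, ← ofReal_norm (derivSymbol L j ξ), norm_derivSymbol,
      ENNReal.ofReal_mul baseFreq_pos.le, pow_one]
    exact le_mul_of_one_le_left zero_le (one_le_ebracket ξ)
  have h3 : absFreq ξ ^ 2 = ∑ j, ENNReal.ofReal |(ξ j : ℝ)| ^ 2 := by
    rw [absFreq, ← ENNReal.ofReal_pow (Real.sqrt_nonneg _), Real.sq_sqrt (by positivity),
      ENNReal.ofReal_sum_of_nonneg fun _ _ => sq_nonneg _]
    refine Finset.sum_congr rfl fun j _ => ?_
    rw [← ENNReal.ofReal_pow (abs_nonneg _), sq_abs]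
  calc _ = ∑ j, ((ENNReal.ofReal (baseFreq L) * ENNReal.ofReal |(ξ j : ℝ)|) *
        ‖coeff v ξ‖ₑ) ^ 2 := by
        simp only [mul_pow, h3, ← Finset.mul_sum, ← Finset.sum_mul]
        ring
    _ ≤ _ := Finset.sum_le_sum fun j _ => pow_le_pow_left' (h2 j) 2

/-! ### A priori bounds for local strong solutions -/

theorem divergence_mulVec_sub_left {v v' : L2 L} (hv : MemSobolev 2 v) (hv' : MemSobolev 2 v')
    {u : Fin 2 → L2 L} (hu : ∀ j, MemSobolev 3 (u j)) :
    divergence (mulVec (v - v') u) = divergence (mulVec v u) - divergence (mulVec v' u) := by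
  have m1 : ∀ j, MemSobolev 1 (mulVec v u j) := fun j => hv.mul (hu j)
  have m2 : ∀ j, MemSobolev 1 (mulVec v' u j) := fun j => hv'.mul (hu j)
  rw [← divergence_sub m1 m2]
  congr 1
  ext1 j
  exact mul_sub_left hv hv' (u j)

theorem divFree_of_dataAssumption {uh : Fin 2 → L2 L} {f b₀ ω₀ : L2 L}
    (hdata : DataAssumption uh f b₀ ω₀) : DivFree uh :=
  divFree_of_divergence_eq_zero (fun j => (hdata.uh_mem j).mono (by omega)) hdata.uh_div

/-- The velocity of a local strong solution, with the equations in transport form. -/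
theorem IsLocalSolution.exists_velocity {α : ℝ} (hα : 0 < α) {uh : Fin 2 → L2 L}
    {f b₀ ω₀ : L2 L} (hdata : DataAssumption uh f b₀ ω₀) {b ω : ℝ → L2 L} {T : ℝ}
    (h : IsLocalSolution α uh f b₀ ω₀ b ω T) :
    ∃ u : ℝ → Fin 2 → L2 L, (∀ t ∈ Icc 0 T, ∀ j, MemSobolev 3 (u t j)) ∧
      (∀ t ∈ Icc 0 T, DivFree (u t)) ∧
      (∀ t ∈ Icc 0 T, velNorm (u t) ≤ velConst L α * (sobolevNorm 0 (ω t) + sobolevNorm 0 f)) ∧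
      ContinuousOn (fun s => divergence (mulVec (b s) (u s)) + 0) (Icc 0 T) ∧
      ContinuousOn (fun s => divergence (mulVec (ω s) (u s)) +
        (divergence (mulVec (b s) uh) - divergence (mulVec (b s) (u s)))) (Icc 0 T) ∧
      (∀ t ∈ Icc 0 T, b t = b₀ - ∫ s in (0 : ℝ)..t, (divergence (mulVec (b s) (u s)) + 0)) ∧
      (∀ t ∈ Icc 0 T, ω t = ω₀ - ∫ s in (0 : ℝ)..t, (divergence (mulVec (ω s) (u s)) +
        (divergence (mulVec (b s) uh) - divergence (mulVec (b s) (u s))))) := by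
  obtain ⟨hT, hb, hω, ψ, hψ, hbeq, hωeq⟩ := h
  have hb2 : ContinuousInSobolev 2 T b := hb.mono (by omega)
  have hu : ∀ t ∈ Icc 0 T, ∀ j, MemSobolev 3 (perpGrad (ψ t) j) := fun t ht =>
    memSobolev_perpGrad (hψ t ht).1
  have hucont : ∀ t ∈ Icc 0 T,
      Tendsto (fun s => velNorm (perpGrad (ψ s) - perpGrad (ψ t))) (𝓝[Icc 0 T] t) (𝓝 0) := by
    intro t ht
    have h1 := ENNReal.Tendsto.const_mul ((hω.mono (show 0 ≤ 2 by omega)).2 t ht)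
      (Or.inr (velConst_ne_top L α))
    rw [mul_zero] at h1
    refine tendsto_of_tendsto_of_tendsto_of_le_of_le' tendsto_const_nhds h1
      (Eventually.of_forall fun _ => zero_le) ?_
    filter_upwards [self_mem_nhdsWithin] with s hs
    exact (hψ s hs).velNorm_sub_le hα (hψ t ht)
  have hcb := continuousOn_transport hb2 hu hucont
  have hcω := continuousOn_transport hω hu hucont
  have hch := continuousOn_transport hb2 (u := fun _ => uh) (fun _ _ => hdata.uh_mem)
    (fun t _ => by simpa [velNorm, sobolevNorm_eq, coeff_zero, l2Norm] using tendsto_const_nhds)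
  refine ⟨fun s => perpGrad (ψ s), hu, fun t ht => divFree_perpGrad (hψ t ht).1, fun t ht => ?_,
    hcb.add continuousOn_const, hcω.add (hch.sub hcb), fun t ht => ?_, fun t ht => ?_⟩
  · refine ((hψ t ht).velNorm_le hα).trans ?_
    gcongr
    exact sobolevNorm_sub_le _ _ _
  -- The zero forcing puts the buoyancy equation in the shape of `sobolev_energy_le`.
  · simpa only [add_zero] using hbeq t ht
  · rw [hωeq t ht]
    congr 1
    refine intervalIntegral.integral_congr fun s hs => ?_
    rw [uIcc_of_le ht.1] at hs
    have hs' : s ∈ Icc 0 T := ⟨hs.1, hs.2.trans ht.2⟩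
    simp only []
    -- Splitting off `div(b u)` leaves pure transport of `ω`, with all terms in `b` collected as
    -- forcing.
    rw [divergence_mulVec_sub_left (hω.1 s hs') (hb2.1 s hs') (hu s hs')]
    abel

theorem IsLocalSolution.memSobolev_b {α : ℝ} {uh : Fin 2 → L2 L} {f b₀ ω₀ : L2 L}
    {b ω : ℝ → L2 L} {T : ℝ} (h : IsLocalSolution α uh f b₀ ω₀ b ω T) {t : ℝ}
    (ht : t ∈ Icc 0 T) : MemSobolev 3 (b t) := h.2.1.1 t ht

theorem IsLocalSolution.memSobolev_omega {α : ℝ} {uh : Fin 2 → L2 L} {f b₀ ω₀ : L2 L}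
    {b ω : ℝ → L2 L} {T : ℝ} (h : IsLocalSolution α uh f b₀ ω₀ b ω T) {t : ℝ}
    (ht : t ∈ Icc 0 T) : MemSobolev 2 (ω t) := h.2.2.1.1 t ht

theorem le_one_add_sq (x : ℝ≥0∞) : x ≤ 1 + x ^ 2 := by
  rcases le_total x 1 with h | h
  · exact h.trans le_self_add
  · exact (le_self_pow h two_ne_zero).trans le_add_self

theorem mul_le_add_sq (x y : ℝ≥0∞) : x * y ≤ y ^ 2 + x ^ 2 := by
  rcases le_total x y with h | h
  · exact (mul_le_mul_left h y).trans (by rw [sq y]; exact le_self_add)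
  · exact (mul_le_mul_right h x).trans (by rw [sq x]; exact le_add_self)

/-- The `L²` norm of the vorticity is controlled by the time integral of `‖∇b‖₂`. -/
theorem exists_l2_bound {α : ℝ} (hα : 0 < α) {uh : Fin 2 → L2 L} {f b₀ ω₀ : L2 L}
    (hdata : DataAssumption uh f b₀ ω₀) :
    ∃ C : ℝ, 0 ≤ C ∧ ∀ (b ω : ℝ → L2 L) (T : ℝ), IsLocalSolution α uh f b₀ ω₀ b ω T →
      ∀ t ∈ Icc 0 T, 1 + (sobolevNorm 0 (ω t)).toReal ^ 2 ≤
        (1 + (sobolevNorm 0 ω₀).toReal ^ 2) *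
          Real.exp (∫ s in (0 : ℝ)..t, C * (gradNorm (b s)).toReal) := by
  set κ := ENNReal.ofReal (baseFreq L) with hκ
  set c := velConst L α with hc
  set φ := sobolevNorm 0 f with hφ
  set V₀ := velNorm uh with hV₀
  have hκt : κ ≠ ∞ := ENNReal.ofReal_ne_top
  have hct : c ≠ ∞ := velConst_ne_top L α
  have hφt : φ ≠ ∞ := (hdata.f_mem.mono (by omega)).ne
  have hVt : V₀ ≠ ∞ := (velNorm_lt_top hdata.uh_mem).ne
  have het := embConst_ne_top
  set K : ℝ≥0∞ := 2 * (κ * embConst * (c + c * φ + V₀)) with hK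
  have hKt : K ≠ ∞ := by finiteness
  set K' : ℝ≥0∞ := 36 * κ * embConst * c with hK'
  have hKt' : K' ≠ ∞ := by finiteness
  clear_value K K'
  -- The constant depends on the data only, not on the time `T`.
  refine ⟨K.toReal, ENNReal.toReal_nonneg, fun b ω T h t ht => ?_⟩
  obtain ⟨u, hu, hdiv, hV, -, hcω, -, hωeq⟩ := h.exists_velocity hα hdata
  have hb2 : ∀ s ∈ Icc 0 T, MemSobolev 2 (b s) := fun s hs => (h.memSobolev_b hs).mono (by omega)
  have hω2 : ∀ s ∈ Icc 0 T, MemSobolev 2 (ω s) := fun s hs => h.memSobolev_omega hs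
  have hgt : ∀ s ∈ Icc 0 T, gradNorm (b s) ≠ ∞ := fun s hs =>
    ((gradNorm_le_sobolevNorm _).trans_lt ((hb2 s hs).mono (by omega))).ne
  have h0t : ∀ s ∈ Icc 0 T, sobolevNorm 0 (ω s) ≠ ∞ := fun s hs =>
    ((hω2 s hs).mono (by omega)).ne
  have hg : ContinuousOn (fun s => (gradNorm (b s)).toReal) (Icc 0 T) :=
    (h.2.1.mono (show 1 ≤ 3 by omega)).continuousOn_gradNorm
  have hn0 : ContinuousOn (fun s => (sobolevNorm 0 (ω s)).toReal) (Icc 0 T) :=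
    (h.2.2.1.mono (show 0 ≤ 2 by omega)).continuousOn_norm
  have hn2 : ContinuousOn (fun s => (sobolevNorm 2 (ω s)).toReal) (Icc 0 T) :=
    h.2.2.1.continuousOn_norm
  have hR : ContinuousOn (fun s => K.toReal * (gradNorm (b s)).toReal *
      (1 + (sobolevNorm 0 (ω s)).toReal ^ 2)) (Icc 0 T) :=
    (continuousOn_const.mul hg).mul (continuousOn_const.add (hn0.pow 2))
  -- This error involves the still uncontrolled `W^{2,2}` norm of `ω`; continuity on `[0, T]`
  -- suffices, as it is multiplied by `ε N → 0`.
  have hD : ContinuousOn (fun s => K'.toReal * (sobolevNorm 2 (ω s)).toReal ^ 2 *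
      ((sobolevNorm 0 (ω s)).toReal + φ.toReal)) (Icc 0 T) :=
    (continuousOn_const.mul (hn2.pow 2)).mul (hn0.add continuousOn_const)
  refine gronwall_integral (y := fun s => 1 + (sobolevNorm 0 (ω s)).toReal ^ 2)
    (h := fun s => K.toReal * (gradNorm (b s)).toReal)
    (continuousOn_const.add (hn0.pow 2)) (continuousOn_const.mul hg)
    (fun s _ => by positivity) (fun t ht => ?_) ht
  have key := l2_energy_le (F := fun s =>
    divergence (mulVec (b s) uh) - divergence (mulVec (b s) (u s))) hω2 hdata.omega_mem hu hdiv
    hcω hωeq hR (fun s _ => by positivity) hD (fun s _ => by positivity) (fun s hs => ?_)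
    (fun s hs => ?_) ht
  · linarith
  · have hF : sobolevNorm 0 (divergence (mulVec (b s) uh) - divergence (mulVec (b s) (u s))) ≤
        κ * embConst * gradNorm (b s) * V₀ +
          κ * embConst * gradNorm (b s) * (c * (sobolevNorm 0 (ω s) + φ)) := by
      refine (sobolevNorm_sub_le _ _ _).trans (add_le_add ?_ ?_)
      · exact sobolevNorm_zero_transport_le (hb2 s hs) hdata.uh_mem
          (divFree_of_dataAssumption hdata)
      · refine (sobolevNorm_zero_transport_le (hb2 s hs) (hu s hs) (hdiv s hs)).trans ?_
        gcongr
        exact hV s hs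
    have hE : ENNReal.ofReal (K.toReal * (gradNorm (b s)).toReal *
        (1 + (sobolevNorm 0 (ω s)).toReal ^ 2)) =
        K * gradNorm (b s) * (1 + sobolevNorm 0 (ω s) ^ 2) := by
      have := h0t s hs
      have := hgt s hs
      rw [← ENNReal.ofReal_toReal (a := K * gradNorm (b s) * (1 + sobolevNorm 0 (ω s) ^ 2))
        (by finiteness), ENNReal.toReal_mul, ENNReal.toReal_mul,
        ENNReal.toReal_add (by simp) (by finiteness), ENNReal.toReal_pow, ENNReal.toReal_one]
    rw [hE]
    set x := sobolevNorm 0 (ω s)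
    calc _ ≤ 2 * x * (κ * embConst * gradNorm (b s) * V₀ +
          κ * embConst * gradNorm (b s) * (c * (x + φ))) := by gcongr
      _ = 2 * κ * embConst * gradNorm (b s) * (V₀ * x + c * x ^ 2 + c * φ * x) := by ring
      -- Terms linear in `x` are absorbed by `x ≤ 1 + x ^ 2`; hence the `1 +` in the Grönwall
      -- quantity.
      _ ≤ 2 * κ * embConst * gradNorm (b s) *
          (V₀ * (1 + x ^ 2) + c * (1 + x ^ 2) + c * φ * (1 + x ^ 2)) := by
          gcongr
          · exact le_one_add_sq x
          · exact le_add_self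
          · exact le_one_add_sq x
      _ = _ := by
          rw [hK]
          ring
  · have hE : ENNReal.ofReal (K'.toReal * (sobolevNorm 2 (ω s)).toReal ^ 2 *
        ((sobolevNorm 0 (ω s)).toReal + φ.toReal)) =
        K' * sobolevNorm 2 (ω s) ^ 2 * (sobolevNorm 0 (ω s) + φ) := by
      have := h0t s hs
      have := (hω2 s hs).ne
      rw [← ENNReal.ofReal_toReal (a := K' * sobolevNorm 2 (ω s) ^ 2 *
        (sobolevNorm 0 (ω s) + φ)) (by finiteness), ENNReal.toReal_mul, ENNReal.toReal_mul,
        ENNReal.toReal_add (by finiteness) (by finiteness), ENNReal.toReal_pow]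
    rw [hE]
    calc _ ≤ 36 * κ * embConst * sobolevNorm 2 (ω s) ^ 2 * (c * (sobolevNorm 0 (ω s) + φ)) := by
          gcongr
          exact hV s hs
      _ = _ := by
          rw [hK']
          ring

/-- Once the `L²` norm of the vorticity is bounded, the norm in `𝓜` grows at most exponentially. -/
theorem exists_sobolev_bound {α : ℝ} (hα : 0 < α) {uh : Fin 2 → L2 L} {f b₀ ω₀ : L2 L}
    (hdata : DataAssumption uh f b₀ ω₀) (M : ℝ) :
    ∃ C : ℝ, 0 ≤ C ∧ ∀ (b ω : ℝ → L2 L) (T : ℝ), IsLocalSolution α uh f b₀ ω₀ b ω T →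
      (∀ t ∈ Icc 0 T, (sobolevNorm 0 (ω t)).toReal ≤ M) →
      ∀ t ∈ Icc 0 T, (sobolevNorm 3 (b t)).toReal ^ 2 + (sobolevNorm 2 (ω t)).toReal ^ 2 ≤
        ((sobolevNorm 3 b₀).toReal ^ 2 + (sobolevNorm 2 ω₀).toReal ^ 2) * Real.exp (t * C) := by
  set κ := ENNReal.ofReal (baseFreq L) with hκ
  set c := velConst L α with hc
  set φ := sobolevNorm 0 f with hφ
  set V₀ := velNorm uh with hV₀
  have hκt : κ ≠ ∞ := ENNReal.ofReal_ne_top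
  have hct : c ≠ ∞ := velConst_ne_top L α
  have hφt : φ ≠ ∞ := (hdata.f_mem.mono (by omega)).ne
  have hVt : V₀ ≠ ∞ := (velNorm_lt_top hdata.uh_mem).ne
  have het := embConst_ne_top
  set V₁ : ℝ≥0∞ := c * (ENNReal.ofReal M + φ) with hV₁
  -- `44 = 36 + 8`: the transport commutator plus twice the constant `4` of the forcing bound.
  set K : ℝ≥0∞ := 44 * κ * embConst * (V₁ + V₀) with hK
  have hKt : K ≠ ∞ := by finiteness
  clear_value K
  refine ⟨2 * K.toReal, by positivity, fun b ω T h hM t ht => ?_⟩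
  obtain ⟨u, hu, hdiv, hV, hcb, hcω, hbeq, hωeq⟩ := h.exists_velocity hα hdata
  have hb3 : ∀ s ∈ Icc 0 T, MemSobolev 3 (b s) := fun s hs => h.memSobolev_b hs
  have hb2 : ∀ s ∈ Icc 0 T, MemSobolev 2 (b s) := fun s hs => (hb3 s hs).mono (by omega)
  have hω2 : ∀ s ∈ Icc 0 T, MemSobolev 2 (ω s) := fun s hs => h.memSobolev_omega hs
  have hV' : ∀ s ∈ Icc 0 T, velNorm (u s) ≤ V₁ := by
    intro s hs
    refine (hV s hs).trans ?_
    rw [hV₁]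
    gcongr
    exact ENNReal.le_ofReal_iff_toReal_le ((hω2 s hs).mono (by omega)).ne
      (ENNReal.toReal_nonneg.trans (hM s hs)) |>.mpr (hM s hs)
  have hn3 : ContinuousOn (fun s => (sobolevNorm 3 (b s)).toReal) (Icc 0 T) :=
    h.2.1.continuousOn_norm
  have hn2 : ContinuousOn (fun s => (sobolevNorm 2 (ω s)).toReal) (Icc 0 T) :=
    h.2.2.1.continuousOn_norm
  set y : ℝ → ℝ := fun s => (sobolevNorm 3 (b s)).toReal ^ 2 + (sobolevNorm 2 (ω s)).toReal ^ 2
    with hy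
  have hyc : ContinuousOn y (Icc 0 T) := (hn3.pow 2).add (hn2.pow 2)
  have hR : ContinuousOn (fun s => K.toReal * y s) (Icc 0 T) := continuousOn_const.mul hyc
  have hR0 : ∀ s ∈ Icc 0 T, 0 ≤ K.toReal * y s := fun s _ => by positivity
  have hE : ∀ s ∈ Icc 0 T, ENNReal.ofReal (K.toReal * y s) =
      K * (sobolevNorm 3 (b s) ^ 2 + sobolevNorm 2 (ω s) ^ 2) := by
    intro s hs
    have := (hb3 s hs).ne
    have := (hω2 s hs).ne
    rw [← ENNReal.ofReal_toReal (a := K * (sobolevNorm 3 (b s) ^ 2 + sobolevNorm 2 (ω s) ^ 2))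
      (by finiteness), ENNReal.toReal_mul, ENNReal.toReal_add (by finiteness) (by finiteness),
      ENNReal.toReal_pow, ENNReal.toReal_pow]
  have hexp : ∫ _ in (0 : ℝ)..t, 2 * K.toReal = t * (2 * K.toReal) := by
    rw [intervalIntegral.integral_const, sub_zero, smul_eq_mul]
  rw [← hexp]
  -- Each of the two energy inequalities has right-hand side `K y`; their sum gives the rate `2 K`.
  refine gronwall_integral (y := y) (h := fun _ => 2 * K.toReal) hyc continuousOn_const
    (fun _ _ => by positivity) (fun t ht => ?_) ht
  have keyb := sobolev_energy_le (F := fun _ => 0) (Or.inr rfl) hb3 hdata.b_mem hu hdiv hcb hbeq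
    hR hR0 (fun s hs => ?_) ht
  have keyω := sobolev_energy_le (F := fun s =>
    divergence (mulVec (b s) uh) - divergence (mulVec (b s) (u s))) (Or.inl rfl) hω2
    hdata.omega_mem hu hdiv hcω hωeq hR hR0 (fun s hs => ?_) ht
  · have e : ∫ s in (0 : ℝ)..t, 2 * K.toReal * y s = 2 * ∫ s in (0 : ℝ)..t, K.toReal * y s := by
      rw [← intervalIntegral.integral_const_mul]
      simp only [mul_assoc]
    rw [e]
    simp only [hy] at keyb keyω ⊢
    linarith
  · rw [hE s hs]
    have hF : sobolevNorm 2 (divergence (mulVec (b s) uh) - divergence (mulVec (b s) (u s))) ≤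
        4 * κ * embConst * sobolevNorm 3 (b s) * V₀ +
          4 * κ * embConst * sobolevNorm 3 (b s) * V₁ := by
      refine (sobolevNorm_sub_le _ _ _).trans (add_le_add ?_ ?_)
      · exact sobolevNorm_two_transport_le (hb2 s hs) hdata.uh_mem
          (divFree_of_dataAssumption hdata)
      · refine (sobolevNorm_two_transport_le (hb2 s hs) (hu s hs) (hdiv s hs)).trans ?_
        gcongr
        exact hV' s hs
    set x := sobolevNorm 2 (ω s)
    set z := sobolevNorm 3 (b s)
    calc _ ≤ 36 * κ * embConst * x ^ 2 * V₁ +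
          2 * x * (4 * κ * embConst * z * V₀ + 4 * κ * embConst * z * V₁) := by
          gcongr
          exact hV' s hs
      _ = 36 * κ * embConst * V₁ * x ^ 2 + 8 * κ * embConst * (V₁ + V₀) * (x * z) := by ring
      _ ≤ 36 * κ * embConst * (V₁ + V₀) * (z ^ 2 + x ^ 2) +
          8 * κ * embConst * (V₁ + V₀) * (z ^ 2 + x ^ 2) := by
          gcongr
          · exact le_self_add
          · exact le_add_self
          · exact mul_le_add_sq x z
      _ = _ := by
          rw [hK]
          ring
  · rw [hE s hs]
    have hz : sobolevNorm 3 (0 : L2 L) = 0 := by simp [sobolevNorm_eq, coeff_zero, l2Norm]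
    rw [hz, mul_zero, add_zero]
    calc _ ≤ 36 * κ * embConst * sobolevNorm 3 (b s) ^ 2 * V₁ := by
          gcongr
          exact hV' s hs
      _ ≤ 44 * κ * embConst * (sobolevNorm 3 (b s) ^ 2 + sobolevNorm 2 (ω s) ^ 2) * (V₁ + V₀) := by
          gcongr
          · norm_num
          · exact le_self_add
          · exact le_self_add
      _ = _ := by
          rw [hK]
          ring

end TQG

end

/-! ### The blow-up criterion. -/

theorem mainTheorem9 (L : ℝ) [Fact (0 < L)] (α : ℝ) (hα : 0 < α)
    (uh : Fin 2 → TQG.L2 L) (f b₀ ω₀ : TQG.L2 L)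
    (hdata : TQG.DataAssumption uh f b₀ ω₀)
    (b ω : ℝ → TQG.L2 L) (Tmax : ℝ≥0∞)
    (hmax : TQG.IsMaximalSolution α uh f b₀ ω₀ b ω Tmax)
    (hfin : Tmax < ∞) :
    ∫⁻ t in Ioo 0 Tmax.toReal, TQG.vectorSobolevNorm 1 (TQG.grad (b t)) = ∞ := by
  by_contra hI
  set I := ∫⁻ t in Ioo 0 Tmax.toReal, TQG.vectorSobolevNorm 1 (TQG.grad (b t)) with hIdef
  obtain ⟨-, T, hmono, hlim, hsol, hlimsup⟩ := hmax
  have hTlt : ∀ n, T n < Tmax.toReal := by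
    intro n
    have h1 : ENNReal.ofReal (T (n + 1)) ≤ Tmax :=
      Monotone.ge_of_tendsto (fun i j hij => ENNReal.ofReal_le_ofReal (hmono.monotone hij)) hlim _
    exact (hmono (Nat.lt_succ_self n)).trans_le ((ENNReal.ofReal_le_iff_le_toReal hfin.ne).mp h1)
  have hκ := TQG.baseFreq_pos (L := L)
  obtain ⟨C, hC0, hC⟩ := TQG.exists_l2_bound hα hdata
  -- `gradNorm` omits the factor `2 π / L` of the true gradient, hence the division.
  set J : ℝ := (I / ENNReal.ofReal (TQG.baseFreq L)).toReal with hJ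
  have hJt : I / ENNReal.ofReal (TQG.baseFreq L) ≠ ∞ :=
    ENNReal.div_ne_top hI (ENNReal.ofReal_pos.mpr hκ).ne'
  have hgrad : ∀ n, ∀ t ∈ Icc 0 (T n), ∫ s in (0 : ℝ)..t, (TQG.gradNorm (b s)).toReal ≤ J := by
    intro n t ht
    rw [intervalIntegral.integral_of_le ht.1]
    refine (ENNReal.ofReal_le_iff_le_toReal hJt).mp ?_
    have hcont : ContinuousOn (fun s => (TQG.gradNorm (b s)).toReal) (Icc 0 (T n)) :=
      ((hsol n).2.1.mono (show 1 ≤ 3 by omega)).continuousOn_gradNorm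
    have hint := (intervalIntegrable_iff_integrableOn_Ioc_of_le ht.1).mp
      (TQG.intervalIntegrable_of_continuousOn hcont ht)
    rw [ofReal_integral_eq_lintegral_ofReal hint
      (Eventually.of_forall fun _ => ENNReal.toReal_nonneg)]
    calc _ ≤ ∫⁻ s in Ioc 0 t, TQG.vectorSobolevNorm 1 (TQG.grad (b s)) *
          (ENNReal.ofReal (TQG.baseFreq L))⁻¹ := by
          refine setLIntegral_mono' measurableSet_Ioc fun s hs => ?_
          have hs' : s ∈ Icc 0 (T n) := ⟨hs.1.le, hs.2.trans ht.2⟩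
          refine ENNReal.ofReal_toReal_le.trans ?_
          rw [← div_eq_mul_inv, ENNReal.le_div_iff_mul_le
            (Or.inl (ENNReal.ofReal_pos.mpr hκ).ne') (Or.inl ENNReal.ofReal_ne_top), mul_comm]
          exact TQG.baseFreq_mul_gradNorm_le (((hsol n).memSobolev_b hs').mono (by omega))
      _ ≤ ∫⁻ s in Ioo 0 Tmax.toReal, TQG.vectorSobolevNorm 1 (TQG.grad (b s)) *
          (ENNReal.ofReal (TQG.baseFreq L))⁻¹ :=
          lintegral_mono_set fun s hs => ⟨hs.1, (hs.2.trans ht.2).trans_lt (hTlt n)⟩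
      _ = _ := by
          -- As the constant is finite, it can be pulled out with no measurability of the norm in
          -- time.
          rw [lintegral_mul_const' _ _
            (ENNReal.inv_ne_top.mpr (ENNReal.ofReal_pos.mpr hκ).ne'), div_eq_mul_inv]
  set M : ℝ := (1 + (TQG.sobolevNorm 0 ω₀).toReal ^ 2) * Real.exp (C * J) with hM
  have hbound0 : ∀ n, ∀ t ∈ Icc 0 (T n), (TQG.sobolevNorm 0 (ω t)).toReal ≤ M := by
    intro n t ht
    have h1 := hC b ω (T n) (hsol n) t ht
    rw [intervalIntegral.integral_const_mul] at h1
    have h2 : Real.exp (C * ∫ s in (0 : ℝ)..t, (TQG.gradNorm (b s)).toReal) ≤ Real.exp (C * J) :=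
      Real.exp_le_exp.mpr (mul_le_mul_of_nonneg_left (hgrad n t ht) hC0)
    have h3 := mul_le_mul_of_nonneg_left h2
      (show 0 ≤ 1 + (TQG.sobolevNorm 0 ω₀).toReal ^ 2 by positivity)
    nlinarith [sq_nonneg ((TQG.sobolevNorm 0 (ω t)).toReal - 1)]
  obtain ⟨C', hC0', hC'⟩ := TQG.exists_sobolev_bound hα hdata M
  set B : ℝ := ((TQG.sobolevNorm 3 b₀).toReal ^ 2 + (TQG.sobolevNorm 2 ω₀).toReal ^ 2) *
    Real.exp (Tmax.toReal * C') with hB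
  -- The factor `2` comes from `(p + q)² ≤ 2 (p² + q²)`; the bound does not depend on `n`.
  have hfinal : ∀ n, TQG.normM (b (T n)) (ω (T n)) ^ 2 ≤ ENNReal.ofReal (2 * B) := by
    intro n
    have hT0 := (hsol n).1
    have ht : T n ∈ Icc 0 (T n) := right_mem_Icc.mpr hT0.le
    have h1 := hC' b ω (T n) (hsol n) (hbound0 n) (T n) ht
    have h2 : Real.exp (T n * C') ≤ Real.exp (Tmax.toReal * C') :=
      Real.exp_le_exp.mpr (mul_le_mul_of_nonneg_right (hTlt n).le hC0')
    have h3 := mul_le_mul_of_nonneg_left h2 (show 0 ≤ (TQG.sobolevNorm 3 b₀).toReal ^ 2 +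
      (TQG.sobolevNorm 2 ω₀).toReal ^ 2 by positivity)
    have f1 := ((hsol n).memSobolev_b ht).ne
    have f2 := ((hsol n).memSobolev_omega ht).ne
    have h4 : TQG.normM (b (T n)) (ω (T n)) ^ 2 ≠ ∞ := by
      unfold TQG.normM
      finiteness
    refine (ENNReal.le_ofReal_iff_toReal_le h4 (by positivity)).mpr ?_
    rw [TQG.normM, ENNReal.toReal_pow, ENNReal.toReal_add f1 f2]
    nlinarith [sq_nonneg ((TQG.sobolevNorm 3 (b (T n))).toReal -
      (TQG.sobolevNorm 2 (ω (T n))).toReal)]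
  have hle : limsup (fun n => TQG.normM (b (T n)) (ω (T n)) ^ 2) atTop ≤ ENNReal.ofReal (2 * B) :=
    limsup_le_of_le (h := Eventually.of_forall hfinal)
  rw [hlimsup hfin] at hle
  exact absurd hle (not_le.mpr ENNReal.ofReal_lt_top)
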